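/- Let $n\ge 100$ and $p$ be natural numbers, let $\Sigma\in\mathbb{R}^{p\times p}$ be a symmetric positive semidefinite matrix with positive semidefinite square root $\Sigma^{1/2}$, and let $Z$ be a random $n\times p$ matrix whose rows are i.i.d. with distribution $\mathcal N_p(0,\Sigma)$. For a nonempty compact set $B\subset\mathbb{R}^p$ let $\mathscr G(B)=\mathbb{E}\big[\sup_{b\in B} b^\top\xi\big]$, with $\xi\sim\mathcal N_p(0,I_p)$, denote its Gaussian width, and let $\mathbb{B}_1^p=\{v\in\mathbb{R}^p:\|v\|_1\le 1\}$. Then for every $\delta\in(0,1/7]$, with probability at least $1-\delta$ the following holds simultaneously for all $v\in\mathbb{R}^p$: $$ \Big\|\tfrac{1}{\sqrt n}Zv\Big\|_2\;\ge\;\Big(1-\frac{4.3+\sqrt{2\log(9/\delta)}}{\sqrt n}\Big)\|\Sigma^{1/2}v\|_2-\frac{1.2\,\mathscr G(\Sigma^{1/2}\mathbb{B}_1^p)}{\sqrt n}\,\|v\|_1 . $$ -/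

import Mathlib

open MeasureTheory ProbabilityTheory
open scoped MatrixOrder

noncomputable section

/-- The matrix-vector product `A v`, as a map between Euclidean spaces, so that `‖mulEuclid A v‖`
is the Euclidean norm `‖A v‖₂`. -/
def mulEuclid {m p : ℕ} (A : Matrix (Fin m) (Fin p) ℝ) (v : EuclideanSpace ℝ (Fin p)) :
    EuclideanSpace ℝ (Fin m) :=
  WithLp.toLp 2 (A.mulVec v.ofLp)

/-- The norm `‖v‖₁ = ∑ j, |v j|`. -/
def l1norm {p : ℕ} (v : EuclideanSpace ℝ (Fin p)) : ℝ := ∑ j, |v j|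

/-- The closed unit ball of the `ℓ¹` norm in `ℝ^p`. -/
def l1ball (p : ℕ) : Set (EuclideanSpace ℝ (Fin p)) := {v | l1norm v ≤ 1}

/-- The Gaussian width `E [sup_{b ∈ B} bᵀ ξ]`, with `ξ` standard Gaussian in `ℝ^p`,
of a (nonempty compact) set `B ⊆ ℝ^p`. -/
def gaussianWidth {p : ℕ} (B : Set (EuclideanSpace ℝ (Fin p))) : ℝ :=
  ∫ ξ, sSup ((fun b => inner ℝ b ξ) '' B) ∂(stdGaussian (EuclideanSpace ℝ (Fin p)))

/-- The positive semidefinite square root `S^{1/2}` of a positive semidefinite matrix `S`. -/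
def sqrtMatrix {p : ℕ} (S : Matrix (Fin p) (Fin p) ℝ) : Matrix (Fin p) (Fin p) ℝ :=
  CFC.sqrt S

/-- The rows of the random matrix `Z` are independent and each has the law `N_p(0, S)`. -/
structure HasIIDGaussianRows {Ω : Type*} [MeasurableSpace Ω] (P : Measure Ω) {n p : ℕ}
    (Z : Ω → Matrix (Fin n) (Fin p) ℝ) (S : Matrix (Fin p) (Fin p) ℝ) : Prop where
  hasLaw_row : ∀ i, HasLaw (fun ω => (WithLp.toLp 2 (Z ω i) : EuclideanSpace ℝ (Fin p)))
    (multivariateGaussian 0 S) P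
  indep_rows : iIndepFun
    (fun i ω => (WithLp.toLp 2 (Z ω i) : EuclideanSpace ℝ (Fin p))) P

end

/-! The proof is a form of Gordon's comparison at the level of exponential moments, followed by
peeling over the `ℓ¹` norm. With `Σ = S`, a row of `Z` has the law of `S^{1/2} ζ_i`, so `Z v` is
distributed as a standard Gaussian matrix applied to `u = S^{1/2} v`, and one may normalize `‖u‖ =
1`.

Over finitely many such `u`, the minimum of the norms is replaced by `softMin`, a log-sum-exp of the
smooth norms `√(1 + ‖x‖²)` at inverse temperature `β`, times `-l`. Interpolating between two
Gaussian vectors and integrating by parts (`integral_exp_le_of_sum_le`) reduces the comparison of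
exponential moments to a pointwise inequality on first and second derivatives. For the matrix
process and the process `‖g‖ + ⟨u, h⟩`, the latter is Gordon's inequality `(1 - ⟨u, u'⟩)(1 - ⟨m,
m'⟩) ≥ 0` averaged under the Gibbs weights (`exists_bddC2_softMin`); it even gains a factor `exp
(-l² / 2)`.

The same interpolation, applied to independent versus identical copies of a function, gives Gaussian
concentration with the sharp constant (`BddC2.integral_exp_le`). The vector side has squared
gradient at most `2 l²`, costing `exp (l²)`; with the gain above, `exp (l² / 2)` remains, and
Chernoff's bound yields the tail `exp (-τ² / 2)`. The mean on the vector side is controlled by `E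
‖g‖ ≥ √n - 1 / √n` up to smoothing, and by `r` times the Gaussian width when the `ℓ¹` norms are at
most `r`. The entropy term `log |T| / β` is made negligible by a large `β`, so the bound does not
depend on the number of vectors and passes to countable families.

Finally, vectors are sorted by the integer part of (`ℓ¹` norm) × (width); the deviation grows
linearly with the level so that the failure probabilities form a geometric series, and a dense
sequence extends the bound to all `v`. -/

/-- The standard Gaussian measure on `ι → ℝ`. -/
noncomputable abbrev gaussPi (ι : Type*) [Fintype ι] : Measure (ι → ℝ) :=
  Measure.pi fun _ => gaussianReal 0 1

/-! ### Standard Gaussian measures: marginals, integration by parts, integrability -/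

section GaussPi

variable {ι κ : Type*} [Fintype ι] [Fintype κ]

theorem gaussPi_map_comp_injective {e : κ → ι} (he : Function.Injective e) :
    (gaussPi ι).map (fun ζ => ζ ∘ e) = gaussPi κ := by
  have h : iIndepFun (fun (i : ι) (ζ : ι → ℝ) => ζ i) (gaussPi ι) :=
    iIndepFun_pi (X := fun _ => id) fun _ => aemeasurable_id
  have h2 := (iIndepFun_iff_map_fun_eq_pi_map (fun k => (measurable_pi_apply (e k)).aemeasurable)).1
    (h.precomp he)
  have h3 : ∀ i : ι, (gaussPi ι).map (fun ζ => ζ i) = gaussianReal 0 1 := fun i =>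
    (measurePreserving_eval (fun _ : ι => gaussianReal 0 1) i).map_eq
  simpa [h3, Function.comp_def] using h2

/-- Resampling one coordinate preserves the product measure; this reduces integration by parts in
many variables to the one-dimensional case. -/
theorem gaussPi_map_update [DecidableEq ι] (i : ι) :
    ((gaussPi ι).prod (gaussianReal 0 1)).map (fun q => Function.update q.1 i q.2) = gaussPi ι := by
  symm
  refine Measure.pi_eq fun s hs => ?_
  have hm : Measurable fun q : (ι → ℝ) × ℝ => Function.update q.1 i q.2 :=
    measurable_update'
  rw [Measure.map_apply hm (MeasurableSet.univ_pi hs)]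
  have : (fun q : (ι → ℝ) × ℝ => Function.update q.1 i q.2) ⁻¹' (Set.univ.pi s) =
      (Set.univ.pi (Function.update s i Set.univ)) ×ˢ s i := by
    ext q
    simp only [Set.mem_preimage, Set.mem_pi, Set.mem_univ, true_implies, Set.mem_prod]
    constructor
    · intro h
      refine ⟨fun j => ?_, by simpa using h i⟩
      by_cases hj : j = i
      · subst hj; simp
      · simpa [Function.update_of_ne hj] using h j
    · rintro ⟨h, h'⟩ j
      by_cases hj : j = i
      · subst hj; simpa using h'
      · simpa [Function.update_of_ne hj] using h j
  rw [this, Measure.prod_prod, Measure.pi_pi, ← Finset.mul_prod_erase _ _ (Finset.mem_univ i),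
    ← Finset.mul_prod_erase _ (fun j => gaussianReal 0 1 (s j)) (Finset.mem_univ i)]
  simp only [Function.update_self, measure_univ, one_mul]
  rw [mul_comm]
  congr 1
  refine Finset.prod_congr rfl fun j hj => ?_
  rw [Function.update_of_ne (Finset.ne_of_mem_erase hj)]

/-- Stein's identity: the Gaussian density `φ` satisfies `φ'(s) = -s φ(s)`, so this is integration
by parts on the line against `φ`. -/
theorem integral_id_mul_gaussianReal {h h' : ℝ → ℝ} (hd : ∀ s, HasDerivAt h (h' s) s)
    (h1 : Integrable h (gaussianReal 0 1)) (h2 : Integrable (fun s => s * h s) (gaussianReal 0 1))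
    (h3 : Integrable h' (gaussianReal 0 1)) :
    ∫ s, s * h s ∂gaussianReal 0 1 = ∫ s, h' s ∂gaussianReal 0 1 := by
  have key : ∀ g : ℝ → ℝ, Integrable g (gaussianReal 0 1) →
      Integrable fun s => gaussianPDFReal 0 1 s * g s := by
    intro g hg
    rw [gaussianReal_of_var_ne_zero _ one_ne_zero, integrable_withDensity_iff_integrable_smul₀'
      (measurable_gaussianPDF 0 1).aemeasurable (.of_forall fun _ => gaussianPDF_lt_top)] at hg
    simpa [toReal_gaussianPDF] using hg
  have hφ : ∀ s, HasDerivAt (gaussianPDFReal 0 1) (-(s * gaussianPDFReal 0 1 s)) s := by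
    intro s
    have h1 : HasDerivAt (fun s : ℝ => -(s ^ 2) / 2) (-s) s := by
      have := ((hasDerivAt_pow 2 s).neg.div_const 2)
      refine this.congr_deriv ?_
      simp; ring
    have e : gaussianPDFReal 0 1 = fun s : ℝ => (√(2 * Real.pi))⁻¹ * Real.exp (-(s ^ 2) / 2) := by
      ext s; simp [gaussianPDFReal]
    rw [e]
    exact (h1.exp.const_mul _).congr_deriv (by ring)
  have := integral_mul_deriv_eq_deriv_mul_of_integrable (u := gaussianPDFReal 0 1) (v := h)
    (u' := fun s => -(s * gaussianPDFReal 0 1 s)) (v' := h')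
    (fun s _ => hφ s) (fun s _ => hd s) (key _ h3)
    ((key _ h2).neg.congr (.of_forall fun s => by simp; ring)) (key _ h1)
  rw [integral_gaussianReal_eq_integral_smul one_ne_zero,
    integral_gaussianReal_eq_integral_smul one_ne_zero]
  simp only [smul_eq_mul]
  rw [this, ← integral_neg]
  exact integral_congr_ae (.of_forall fun s => by ring)

/-- Gaussian integration by parts in the coordinate `i`. -/
theorem integral_eval_mul_gaussPi [DecidableEq ι] (i : ι) {G G' : (ι → ℝ) → ℝ}
    (hd : ∀ ζ s, HasDerivAt (fun s => G (Function.update ζ i s)) (G' (Function.update ζ i s)) s)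
    (h1 : Integrable G (gaussPi ι)) (h2 : Integrable (fun ζ => ζ i * G ζ) (gaussPi ι))
    (h3 : Integrable G' (gaussPi ι)) :
    ∫ ζ, ζ i * G ζ ∂gaussPi ι = ∫ ζ, G' ζ ∂gaussPi ι := by
  have hm : Measurable fun q : (ι → ℝ) × ℝ => Function.update q.1 i q.2 :=
    measurable_update'
  have hmp : MeasurePreserving (fun q : (ι → ℝ) × ℝ => Function.update q.1 i q.2)
      ((gaussPi ι).prod (gaussianReal 0 1)) (gaussPi ι) := ⟨hm, gaussPi_map_update i⟩
  have key : ∀ g : (ι → ℝ) → ℝ, Integrable g (gaussPi ι) →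
      Integrable (fun q : (ι → ℝ) × ℝ => g (Function.update q.1 i q.2))
        ((gaussPi ι).prod (gaussianReal 0 1)) ∧
      ∫ ζ, g ζ ∂gaussPi ι =
        ∫ ζ, ∫ s, g (Function.update ζ i s) ∂gaussianReal 0 1 ∂gaussPi ι := by
    intro g hg
    have hi : Integrable (fun q : (ι → ℝ) × ℝ => g (Function.update q.1 i q.2))
        ((gaussPi ι).prod (gaussianReal 0 1)) := hmp.integrable_comp_of_integrable hg
    refine ⟨hi, ?_⟩
    rw [← integral_prod _ hi]
    conv_lhs => rw [← hmp.map_eq]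
    rw [integral_map hm.aemeasurable]
    rw [hmp.map_eq]; exact hg.1
  rw [(key _ h2).2, (key _ h3).2]
  refine integral_congr_ae ?_
  filter_upwards [(key _ h1).1.prod_right_ae, (key _ h2).1.prod_right_ae,
    (key _ h3).1.prod_right_ae] with ζ a1 a2 a3
  simp only [Function.update_self] at a2 ⊢
  exact integral_id_mul_gaussianReal (hd ζ) a1 a2 a3

theorem integrable_exp_sum_abs_gaussPi (c : ℝ) :
    Integrable (fun ζ : ι → ℝ => Real.exp (c * ∑ i, |ζ i|)) (gaussPi ι) := by
  have h : Integrable (fun x : ℝ => Real.exp (c * |x|)) (gaussianReal 0 1) :=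
    integrable_exp_mul_abs (X := fun x => x) (integrable_exp_mul_gaussianReal c)
      (integrable_exp_mul_gaussianReal (-c))
  refine (Integrable.fintype_prod (f := fun _ : ι => fun x : ℝ => Real.exp (c * |x|))
    fun _ => h).congr (.of_forall fun ζ => ?_)
  simp [← Real.exp_sum, Finset.mul_sum]

theorem integrable_of_le_exp_sum_abs {G : (ι → ℝ) → ℝ} (hG : AEStronglyMeasurable G (gaussPi ι))
    (C c : ℝ) (h : ∀ ζ, |G ζ| ≤ C * Real.exp (c * ∑ i, |ζ i|)) : Integrable G (gaussPi ι) :=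
  ((integrable_exp_sum_abs_gaussPi c).const_mul C).mono' hG (.of_forall fun ζ => by simpa using h ζ)

/-- Currying turns the standard Gaussian measure on `κ × ι → ℝ` into a product of such measures. -/
theorem gaussPi_map_curry :
    (gaussPi (κ × ι)).map Function.curry = Measure.pi fun _ : κ => gaussPi ι := by
  have := Measure.infinitePi_map_curry (ι := κ) (κ := ι) (X := ℝ)
    (fun _ _ => gaussianReal 0 1)
  rw [Measure.infinitePi_eq_pi] at this
  simp only [Measure.infinitePi_eq_pi] at this
  exact this

end GaussPi

/-! ### Functions with bounded first and second derivatives, and log-sum-exp -/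

/-- `f` is twice differentiable with first derivative `f'` and second directional derivatives `f''`,
which are continuous and bounded. -/
structure BddC2 {V : Type*} [NormedAddCommGroup V] [NormedSpace ℝ V] (f : V → ℝ)
    (f' : V → V →L[ℝ] ℝ) (f'' : V → V → V → ℝ) : Prop where
  hasFDerivAt : ∀ z, HasFDerivAt f (f' z) z
  hasDerivAt_line : ∀ z a b, HasDerivAt (fun s : ℝ => f' (z + s • b) a) (f'' z a b) 0
  bound : ∃ K : ℝ, 0 ≤ K ∧ (∀ z a, |f' z a| ≤ K * ‖a‖) ∧ ∀ z a b, |f'' z a b| ≤ K * (‖a‖ * ‖b‖)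
  continuous_fst : ∀ a, Continuous fun z => f' z a
  continuous_snd : ∀ a b, Continuous fun z => f'' z a b

/-- The Gibbs weights of `s` at inverse temperature `β`. -/
noncomputable def gibbs {T : Type*} [Fintype T] (β : ℝ) (s : T → ℝ) (v : T) : ℝ :=
  Real.exp (β * s v) / ∑ w, Real.exp (β * s w)

section BddC2

variable {U V T : Type*} [NormedAddCommGroup V] [NormedSpace ℝ V] [NormedAddCommGroup U]
  [NormedSpace ℝ U] [Fintype T]

theorem gibbs_nonneg (β : ℝ) (s : T → ℝ) (v : T) : 0 ≤ gibbs β s v := by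
  unfold gibbs; positivity

theorem sum_exp_pos [Nonempty T] (β : ℝ) (s : T → ℝ) : 0 < ∑ w, Real.exp (β * s w) :=
  Finset.sum_pos (fun _ _ => Real.exp_pos _) Finset.univ_nonempty

theorem sum_gibbs [Nonempty T] (β : ℝ) (s : T → ℝ) : ∑ v, gibbs β s v = 1 := by
  unfold gibbs
  rw [← Finset.sum_div, div_self (sum_exp_pos β s).ne']

theorem abs_sum_gibbs_mul_le [Nonempty T] (β : ℝ) (s : T → ℝ) {x : T → ℝ} {M : ℝ}
    (h : ∀ v, |x v| ≤ M) : |∑ v, gibbs β s v * x v| ≤ M := by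
  refine (Finset.abs_sum_le_sum_abs _ _).trans ?_
  calc ∑ v, |gibbs β s v * x v| ≤ ∑ v, gibbs β s v * M := by
        refine Finset.sum_le_sum fun v _ => ?_
        rw [abs_mul, abs_of_nonneg (gibbs_nonneg β s v)]
        exact mul_le_mul_of_nonneg_left (h v) (gibbs_nonneg β s v)
    _ = M := by rw [← Finset.sum_mul, sum_gibbs, one_mul]

namespace BddC2

theorem continuous {f : V → ℝ} {f' : V → V →L[ℝ] ℝ} {f'' : V → V → V → ℝ} (h : BddC2 f f' f'') :
    Continuous f :=
  continuous_iff_continuousAt.2 fun z => (h.hasFDerivAt z).continuousAt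

theorem hasDerivAt_comp_line {f : V → ℝ} {f' : V → V →L[ℝ] ℝ} {f'' : V → V → V → ℝ}
    (h : BddC2 f f' f'') (z b : V) : HasDerivAt (fun s : ℝ => f (z + s • b)) (f' z b) 0 := by
  have h1 : HasDerivAt (fun s : ℝ => z + s • b) b 0 := by
    simpa using ((hasDerivAt_id (0 : ℝ)).smul_const b).const_add z
  have h2 := h.hasFDerivAt (z + (0 : ℝ) • b)
  simpa [Function.comp_def] using h2.comp_hasDerivAt (0 : ℝ) h1

theorem abs_le {f : V → ℝ} {f' : V → V →L[ℝ] ℝ} {f'' : V → V → V → ℝ} (h : BddC2 f f' f'') :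
    ∃ K : ℝ, 0 ≤ K ∧ ∀ z, |f z| ≤ |f 0| + K * ‖z‖ := by
  obtain ⟨K, hK, h1, -⟩ := h.bound
  refine ⟨K, hK, fun z => ?_⟩
  have := Convex.norm_image_sub_le_of_norm_hasFDerivWithin_le (f := f) (f' := f') (C := K)
    (s := Set.univ) (x := 0) (y := z) (fun x _ => (h.hasFDerivAt x).hasFDerivWithinAt)
    (fun x _ => ContinuousLinearMap.opNorm_le_bound _ hK fun a => h1 x a) convex_univ
    (Set.mem_univ _) (Set.mem_univ _)
  rw [sub_zero, Real.norm_eq_abs] at this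
  have h3 := abs_add_le (f z - f 0) (f 0)
  rw [sub_add_cancel] at h3
  linarith

theorem comp {f : V → ℝ} {f' : V → V →L[ℝ] ℝ} {f'' : V → V → V → ℝ} (h : BddC2 f f' f'')
    (L : U →L[ℝ] V) :
    BddC2 (fun u => f (L u)) (fun u => (f' (L u)).comp L) (fun u a b => f'' (L u) (L a) (L b)) where
  hasFDerivAt u := (h.hasFDerivAt (L u)).comp u L.hasFDerivAt
  hasDerivAt_line u a b := by simpa using h.hasDerivAt_line (L u) (L a) (L b)
  bound := by
    obtain ⟨K, hK, h1, h2⟩ := h.bound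
    refine ⟨K * ‖L‖ + K * (‖L‖ * ‖L‖), by positivity, fun u a => ?_, fun u a b => ?_⟩
    · refine (h1 (L u) (L a)).trans ?_
      have := mul_le_mul_of_nonneg_left (L.le_opNorm a) hK
      have : 0 ≤ K * (‖L‖ * ‖L‖) * ‖a‖ := by positivity
      nlinarith
    · refine (h2 _ _ _).trans ?_
      have := mul_le_mul_of_nonneg_left
        (mul_le_mul (L.le_opNorm a) (L.le_opNorm b) (norm_nonneg _) (by positivity)) hK
      have : 0 ≤ K * ‖L‖ * (‖a‖ * ‖b‖) := by positivity
      nlinarith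
  continuous_fst a := (h.continuous_fst (L a)).comp L.continuous
  continuous_snd a b := (h.continuous_snd (L a) (L b)).comp L.continuous

theorem sum {f : T → V → ℝ} {f' : T → V → V →L[ℝ] ℝ} {f'' : T → V → V → V → ℝ}
    (h : ∀ t, BddC2 (f t) (f' t) (f'' t)) (c : T → ℝ) :
    BddC2 (fun z => ∑ t, c t * f t z) (fun z => ∑ t, c t • f' t z)
      (fun z a b => ∑ t, c t * f'' t z a b) where
  hasFDerivAt z := HasFDerivAt.fun_sum fun t _ => ((h t).hasFDerivAt z).const_mul (c t)
  hasDerivAt_line z a b := by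
    simpa using HasDerivAt.fun_sum (u := Finset.univ)
      fun t _ => ((h t).hasDerivAt_line z a b).const_mul (c t)
  bound := by
    choose K hK h1 h2 using fun t => (h t).bound
    refine ⟨∑ t, |c t| * K t, Finset.sum_nonneg fun t _ => mul_nonneg (abs_nonneg _) (hK t),
      fun z a => ?_, fun z a b => ?_⟩
    · simp only [sum_apply, smul_apply, smul_eq_mul,
        Finset.sum_mul]
      refine (Finset.abs_sum_le_sum_abs _ _).trans (Finset.sum_le_sum fun t _ => ?_)
      rw [abs_mul, mul_assoc]
      exact mul_le_mul_of_nonneg_left (h1 t z a) (abs_nonneg _)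
    · rw [Finset.sum_mul]
      refine (Finset.abs_sum_le_sum_abs _ _).trans (Finset.sum_le_sum fun t _ => ?_)
      rw [abs_mul, mul_assoc]
      exact mul_le_mul_of_nonneg_left (h2 t z a b) (abs_nonneg _)
  continuous_fst a := by
    simp only [sum_apply, smul_apply, smul_eq_mul]
    exact continuous_finsetSum _ fun t _ => ((h t).continuous_fst a).const_mul _
  continuous_snd a b := continuous_finsetSum _ fun t _ => ((h t).continuous_snd a b).const_mul _

theorem const_mul {f : V → ℝ} {f' : V → V →L[ℝ] ℝ} {f'' : V → V → V → ℝ} (h : BddC2 f f' f'')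
    (c : ℝ) : BddC2 (fun z => c * f z) (fun z => c • f' z) (fun z a b => c * f'' z a b) := by
  simpa using sum (T := Unit) (fun _ => h) fun _ => c

theorem continuous_gibbs {X : Type*} [TopologicalSpace X] [Nonempty T] {η : T → X → ℝ}
    (hη : ∀ t, Continuous (η t)) (β : ℝ) (v : T) : Continuous fun z => gibbs β (fun t => η t z) v := by
  unfold gibbs
  refine Continuous.div ?_ ?_ fun z => (sum_exp_pos β _).ne'
  · exact Real.continuous_exp.comp ((hη v).const_mul β)
  · exact continuous_finsetSum _ fun t _ => Real.continuous_exp.comp ((hη t).const_mul β)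

/-- The gradient is a Gibbs average of gradients. Differentiating the Gibbs weights adds `β²` times
the Gibbs covariance of the first derivatives to the averaged Hessian. Averages of bounded
quantities stay bounded. -/
theorem logSumExp [Nonempty T] {η : T → V → ℝ} {η' : T → V → V →L[ℝ] ℝ} {η'' : T → V → V → V → ℝ}
    (h : ∀ t, BddC2 (η t) (η' t) (η'' t)) (β : ℝ) :
    BddC2 (fun z => Real.log (∑ t, Real.exp (β * η t z)))
      (fun z => β • ∑ t, gibbs β (fun t => η t z) t • η' t z)
      (fun z a b => β * ∑ t, gibbs β (fun t => η t z) t * η'' t z a b +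
        β ^ 2 * (∑ t, gibbs β (fun t => η t z) t * (η' t z a * η' t z b) -
          (∑ t, gibbs β (fun t => η t z) t * η' t z a) *
            ∑ t, gibbs β (fun t => η t z) t * η' t z b)) where
  hasFDerivAt z := by
    have h1 : HasFDerivAt (fun z => ∑ t, Real.exp (β * η t z))
        (∑ t, Real.exp (β * η t z) • β • η' t z) z :=
      HasFDerivAt.fun_sum fun t _ => (((h t).hasFDerivAt z).const_mul β).exp
    refine (h1.log (sum_exp_pos β _).ne').congr_fderiv ?_
    rw [Finset.smul_sum, Finset.smul_sum]
    refine Finset.sum_congr rfl fun t _ => ?_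
    rw [smul_smul, smul_smul, smul_smul]
    congr 1
    unfold gibbs
    rw [div_eq_mul_inv]; ring
  hasDerivAt_line z a b := by
    have hS := (sum_exp_pos β (fun t => η t z)).ne'
    have hE : ∀ t, HasDerivAt (fun s : ℝ => Real.exp (β * η t (z + s • b)))
        (Real.exp (β * η t z) * (β * η' t z b)) 0 := fun t => by
      simpa using (((h t).hasDerivAt_comp_line z b).const_mul β).exp
    have hq : ∀ t, HasDerivAt (fun s : ℝ => gibbs β (fun t => η t (z + s • b)) t)
        (gibbs β (fun t => η t z) t * (β * η' t z b -
          β * ∑ w, gibbs β (fun t => η t z) w * η' w z b)) 0 := fun t => by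
      have hsum : HasDerivAt (fun s : ℝ => ∑ t, Real.exp (β * η t (z + s • b)))
          (∑ t, Real.exp (β * η t z) * (β * η' t z b)) 0 := HasDerivAt.fun_sum fun t _ => hE t
      have := (hE t).div hsum (by simpa using hS)
      simp only [zero_smul, add_zero] at this
      refine this.congr_deriv ?_
      have e : ∑ t, Real.exp (β * η t z) * (β * η' t z b) =
          (∑ w, Real.exp (β * η w z)) * (β * ∑ w, gibbs β (fun t => η t z) w * η' w z b) := by
        unfold gibbs
        rw [mul_left_comm, Finset.mul_sum, Finset.mul_sum]
        refine Finset.sum_congr rfl fun w _ => ?_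
        field_simp
      rw [e]
      unfold gibbs
      field_simp
    have := (HasDerivAt.fun_sum (u := Finset.univ)
      fun t _ => (hq t).mul ((h t).hasDerivAt_line z a b)).const_mul β
    simp only [smul_apply, sum_apply, smul_eq_mul]
    refine this.congr_deriv ?_
    simp only [zero_smul, add_zero]
    set B := ∑ w, gibbs β (fun t => η t z) w * η' w z b
    have e : ∀ t, gibbs β (fun t => η t z) t * (β * η' t z b - β * B) * η' t z a +
        gibbs β (fun t => η t z) t * η'' t z a b =
        gibbs β (fun t => η t z) t * η'' t z a b +
          β * (gibbs β (fun t => η t z) t * (η' t z a * η' t z b)) -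
          β * B * (gibbs β (fun t => η t z) t * η' t z a) := fun t => by ring
    simp only [e, Finset.sum_add_distrib, Finset.sum_sub_distrib, ← Finset.mul_sum]
    ring
  bound := by
    choose K hK h1 h2 using fun t => (h t).bound
    have hKs : ∀ t, K t ≤ ∑ t, K t := fun t =>
      Finset.single_le_sum (fun t _ => hK t) (Finset.mem_univ t)
    set M := ∑ t, K t
    have hM : 0 ≤ M := Finset.sum_nonneg fun t _ => hK t
    have b1 : ∀ t z a, |η' t z a| ≤ M * ‖a‖ := fun t z a =>
      (h1 t z a).trans (mul_le_mul_of_nonneg_right (hKs t) (norm_nonneg _))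
    have b2 : ∀ t z a b, |η'' t z a b| ≤ M * (‖a‖ * ‖b‖) := fun t z a b =>
      (h2 t z a b).trans (mul_le_mul_of_nonneg_right (hKs t) (by positivity))
    refine ⟨|β| * M + β ^ 2 * (2 * M ^ 2), by positivity, fun z a => ?_, fun z a b => ?_⟩
    · simp only [smul_apply, sum_apply, smul_eq_mul,
        abs_mul]
      have := mul_le_mul_of_nonneg_left
        (abs_sum_gibbs_mul_le β (fun t => η t z) (fun t => b1 t z a)) (abs_nonneg β)
      have : 0 ≤ β ^ 2 * (2 * M ^ 2) * ‖a‖ := by positivity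
      nlinarith
    · have c1 := mul_le_mul_of_nonneg_left
        (abs_sum_gibbs_mul_le β (fun t => η t z) (fun t => b2 t z a b)) (abs_nonneg β)
      have c2 : |∑ t, gibbs β (fun t => η t z) t * (η' t z a * η' t z b)| ≤
          M ^ 2 * (‖a‖ * ‖b‖) := by
        refine abs_sum_gibbs_mul_le β _ fun t => ?_
        rw [abs_mul]
        calc _ ≤ (M * ‖a‖) * (M * ‖b‖) :=
              mul_le_mul (b1 t z a) (b1 t z b) (abs_nonneg _) (by positivity)
          _ = _ := by ring
      have c3 : |(∑ t, gibbs β (fun t => η t z) t * η' t z a) *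
            ∑ t, gibbs β (fun t => η t z) t * η' t z b| ≤ M ^ 2 * (‖a‖ * ‖b‖) := by
        rw [abs_mul]
        calc _ ≤ (M * ‖a‖) * (M * ‖b‖) :=
              mul_le_mul (abs_sum_gibbs_mul_le β _ fun t => b1 t z a)
                (abs_sum_gibbs_mul_le β _ fun t => b1 t z b) (abs_nonneg _) (by positivity)
          _ = _ := by ring
      refine (abs_add_le _ _).trans ?_
      rw [abs_mul, abs_mul, abs_of_nonneg (sq_nonneg β)]
      have := mul_le_mul_of_nonneg_left ((abs_sub _ _).trans (add_le_add c2 c3)) (sq_nonneg β)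
      nlinarith
  continuous_fst a := by
    simp only [smul_apply, sum_apply, smul_eq_mul]
    exact (continuous_finsetSum _ fun t _ => (continuous_gibbs (fun t => (h t).continuous) β t).mul
      ((h t).continuous_fst a)).const_mul β
  continuous_snd a b := by
    have hg := continuous_gibbs (fun t => (h t).continuous) β
    refine ((continuous_finsetSum _ fun t _ => (hg t).mul ((h t).continuous_snd a b)).const_mul
      β).add (Continuous.const_mul (.sub ?_ (.mul ?_ ?_)) _)
    · exact continuous_finsetSum _ fun t _ => (hg t).mul
        (((h t).continuous_fst a).mul ((h t).continuous_fst b))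
    · exact continuous_finsetSum _ fun t _ => (hg t).mul ((h t).continuous_fst a)
    · exact continuous_finsetSum _ fun t _ => (hg t).mul ((h t).continuous_fst b)

end BddC2

end BddC2

/-! ### The smooth norm `√(1 + ‖x‖²)` -/

section SmoothNorm

variable {H : Type*} [NormedAddCommGroup H]

/-- A smooth approximation of the norm of an inner product space. -/
noncomputable def smoothNorm (x : H) : ℝ := √(1 + ‖x‖ ^ 2)

theorem one_le_smoothNorm (x : H) : 1 ≤ smoothNorm x := by
  unfold smoothNorm
  rw [Real.one_le_sqrt]
  nlinarith [sq_nonneg ‖x‖]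

theorem norm_le_smoothNorm (x : H) : ‖x‖ ≤ smoothNorm x :=
  Real.le_sqrt_of_sq_le (by linarith)

theorem smoothNorm_le (x : H) : smoothNorm x ≤ ‖x‖ + 1 := by
  unfold smoothNorm
  rw [Real.sqrt_le_left (by positivity)]
  nlinarith [norm_nonneg x]

theorem continuous_smoothNorm : Continuous (smoothNorm : H → ℝ) := by
  unfold smoothNorm; fun_prop

variable [InnerProductSpace ℝ H]

/-- The gradient of `smoothNorm`. -/
noncomputable def smoothNormGrad (x : H) : H := (smoothNorm x)⁻¹ • x

theorem norm_smoothNormGrad_le (x : H) : ‖smoothNormGrad x‖ ≤ 1 := by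
  have h := one_le_smoothNorm x
  rw [smoothNormGrad, norm_smul, norm_inv, Real.norm_of_nonneg (by linarith),
    inv_mul_le_one₀ (by linarith)]
  exact norm_le_smoothNorm x

theorem hasDerivAt_smoothNorm_line (x b : H) :
    HasDerivAt (fun s : ℝ => smoothNorm (x + s • b)) (inner ℝ x b / smoothNorm x) 0 := by
  have h1 : HasDerivAt (fun s : ℝ => x + s • b) b 0 := by
    simpa using ((hasDerivAt_id (0 : ℝ)).smul_const b).const_add x
  have h2 := (h1.norm_sq.const_add 1).sqrt (by positivity)
  refine h2.congr_deriv ?_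
  simp only [zero_smul, add_zero, smoothNorm]
  field_simp

theorem BddC2.smoothNorm : BddC2 (smoothNorm : H → ℝ) (fun x => innerSL ℝ (smoothNormGrad x))
    (fun x a b => inner ℝ a b / _root_.smoothNorm x -
      inner ℝ x a * inner ℝ x b / _root_.smoothNorm x ^ 3) where
  hasFDerivAt x := by
    have h := ((hasFDerivAt_id x).norm_sq.const_add 1).sqrt (by positivity)
    refine h.congr_fderiv ?_
    ext a
    simp [smoothNormGrad, _root_.smoothNorm]
    ring
  hasDerivAt_line x a b := by
    have hN := one_le_smoothNorm x
    have h1 : HasDerivAt (fun s : ℝ => inner ℝ (x + s • b) a) (inner ℝ b a) 0 := by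
      have := (hasDerivAt_mul_const (x := (0 : ℝ)) (inner ℝ b a)).const_add (inner ℝ x a)
      refine this.congr_of_eventuallyEq (.of_forall fun s => ?_)
      simp [inner_add_left, inner_smul_left]
    have h2 := h1.div (hasDerivAt_smoothNorm_line x b) (by simp; linarith)
    refine (h2.congr_deriv ?_).congr_of_eventuallyEq (.of_forall fun s => ?_)
    · simp only [zero_smul, add_zero, real_inner_comm b a]
      field_simp
    · simp only [coe_innerSL_apply, smoothNormGrad, real_inner_smul_left, Pi.div_apply]
      ring
  bound := by
    have hN := fun x : H => one_le_smoothNorm x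
    refine ⟨2, by norm_num, fun x a => ?_, fun x a b => ?_⟩
    · rw [innerSL_apply_apply]
      have := (abs_real_inner_le_norm (smoothNormGrad x) a).trans
        (mul_le_mul_of_nonneg_right (norm_smoothNormGrad_le x) (norm_nonneg a))
      linarith [norm_nonneg a]
    · have c1 : |inner ℝ a b / _root_.smoothNorm x| ≤ ‖a‖ * ‖b‖ := by
        rw [abs_div, abs_of_nonneg (by linarith [hN x] : 0 ≤ _root_.smoothNorm x)]
        exact (div_le_self (abs_nonneg _) (hN x)).trans (abs_real_inner_le_norm a b)
      have c2 : |inner ℝ x a * inner ℝ x b / _root_.smoothNorm x ^ 3| ≤ ‖a‖ * ‖b‖ := by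
        have e : inner ℝ x a * inner ℝ x b / _root_.smoothNorm x ^ 3 =
            inner ℝ (smoothNormGrad x) a * inner ℝ (smoothNormGrad x) b / _root_.smoothNorm x := by
          simp only [smoothNormGrad, inner_smul_left, RCLike.conj_to_real]
          have := hN x
          field_simp
        have d : ∀ y, |inner ℝ (smoothNormGrad x) y| ≤ ‖y‖ := fun y => by
          have := (abs_real_inner_le_norm (smoothNormGrad x) y).trans
            (mul_le_mul_of_nonneg_right (norm_smoothNormGrad_le x) (norm_nonneg y))
          linarith
        rw [e, abs_div, abs_of_nonneg (by linarith [hN x] : 0 ≤ _root_.smoothNorm x), abs_mul]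
        exact (div_le_self (by positivity) (hN x)).trans
          (mul_le_mul (d a) (d b) (abs_nonneg _) (norm_nonneg _))
      exact (abs_sub _ _).trans (by linarith)
  continuous_fst a := by
    simp only [innerSL_apply_apply, smoothNormGrad, inner_smul_left]
    exact (continuous_smoothNorm.inv₀ fun x => by have := one_le_smoothNorm x; linarith).mul
      (continuous_id.inner continuous_const)
  continuous_snd a b := by
    have hN := fun x : H => one_le_smoothNorm x
    refine .sub (continuous_const.div continuous_smoothNorm fun x => ?_)
      (.div (by fun_prop) (continuous_smoothNorm.pow 3) fun x => ?_)
    · have := hN x; positivity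
    · have := hN x; positivity

end SmoothNorm

/-! ### Differentiating Gaussian exponential moments along a path -/

section Interpolation

variable {V ι : Type*} [NormedAddCommGroup V] [NormedSpace ℝ V] [Fintype ι]

theorem norm_sum_mul_smul_le {c : ι → ℝ} (hc : ∀ i, |c i| ≤ 1) (a : ι → V) (ζ : ι → ℝ) :
    ‖∑ i, (c i * ζ i) • a i‖ ≤ (∑ i, ‖a i‖) * ∑ i, |ζ i| := by
  refine (norm_sum_le _ _).trans ?_
  rw [Finset.sum_mul]
  refine Finset.sum_le_sum fun i _ => ?_
  rw [norm_smul, Real.norm_eq_abs, abs_mul, mul_comm]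
  refine mul_le_mul_of_nonneg_left ?_ (norm_nonneg _)
  calc |c i| * |ζ i| ≤ 1 * |ζ i| := mul_le_mul_of_nonneg_right (hc i) (abs_nonneg _)
    _ = |ζ i| := one_mul _
    _ ≤ _ := Finset.single_le_sum (f := fun i => |ζ i|) (fun i _ => abs_nonneg _)
      (Finset.mem_univ i)

theorem continuous_sum_mul_smul (c : ι → ℝ) (a : ι → V) :
    Continuous fun ζ : ι → ℝ => ∑ i, (c i * ζ i) • a i := by fun_prop

namespace BddC2

variable {f : V → ℝ} {f' : V → V →L[ℝ] ℝ} {f'' : V → V → V → ℝ}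

/-- A bounded gradient forces linear growth. The constants are uniform over coefficients bounded by
`1`, which supplies the domination needed to differentiate along a path. -/
theorem exists_exp_le (hf : BddC2 f f' f'') (a : ι → V) : ∃ C k : ℝ, 0 ≤ C ∧ 0 ≤ k ∧
    ∀ c : ι → ℝ, (∀ i, |c i| ≤ 1) → ∀ ζ : ι → ℝ,
      Real.exp (f (∑ i, (c i * ζ i) • a i)) ≤ C * Real.exp (k * ∑ i, |ζ i|) := by
  obtain ⟨K, hK, h⟩ := hf.abs_le
  refine ⟨Real.exp |f 0|, K * ∑ i, ‖a i‖, (Real.exp_pos _).le,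
    mul_nonneg hK (Finset.sum_nonneg fun _ _ => norm_nonneg _), fun c hc ζ => ?_⟩
  rw [← Real.exp_add, Real.exp_le_exp]
  have h1 := (le_abs_self _).trans (h (∑ i, (c i * ζ i) • a i))
  have h2 := mul_le_mul_of_nonneg_left (norm_sum_mul_smul_le hc a ζ) hK
  linarith

theorem integrable_exp_comp (hf : BddC2 f f' f'') (a : ι → V) {c : ι → ℝ} (hc : ∀ i, |c i| ≤ 1) :
    Integrable (fun ζ => Real.exp (f (∑ i, (c i * ζ i) • a i))) (gaussPi ι) := by
  obtain ⟨C, k, -, -, h⟩ := hf.exists_exp_le a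
  refine integrable_of_le_exp_sum_abs (Real.continuous_exp.comp
    (hf.continuous.comp (continuous_sum_mul_smul c a))).aestronglyMeasurable C k fun ζ => ?_
  rw [abs_of_nonneg (Real.exp_pos _).le]
  exact h c hc ζ

theorem integral_eval_mul_exp (hf : BddC2 f f' f'') (a : ι → V) {c : ι → ℝ}
    (hc : ∀ i, |c i| ≤ 1) (i : ι) :
    Integrable (fun ζ => ζ i * (Real.exp (f (∑ i, (c i * ζ i) • a i)) *
      f' (∑ i, (c i * ζ i) • a i) (a i))) (gaussPi ι) ∧
    Integrable (fun ζ => c i * (Real.exp (f (∑ i, (c i * ζ i) • a i)) *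
        (f' (∑ i, (c i * ζ i) • a i) (a i) ^ 2 +
          f'' (∑ i, (c i * ζ i) • a i) (a i) (a i)))) (gaussPi ι) ∧
    ∫ ζ, ζ i * (Real.exp (f (∑ i, (c i * ζ i) • a i)) * f' (∑ i, (c i * ζ i) • a i) (a i))
        ∂gaussPi ι =
      ∫ ζ, c i * (Real.exp (f (∑ i, (c i * ζ i) • a i)) *
        (f' (∑ i, (c i * ζ i) • a i) (a i) ^ 2 +
          f'' (∑ i, (c i * ζ i) • a i) (a i) (a i))) ∂gaussPi ι := by
  classical
  obtain ⟨C, k, hC, hk, hexp⟩ := hf.exists_exp_le a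
  obtain ⟨K, hK, hb1, hb2⟩ := hf.bound
  have hx := continuous_sum_mul_smul c a
  have hcx := Real.continuous_exp.comp (hf.continuous.comp hx)
  have hc1 := (hf.continuous_fst (a i)).comp hx
  have hc2 := (hf.continuous_snd (a i) (a i)).comp hx
  have hr : ∀ ζ : ι → ℝ, |ζ i| ≤ ∑ i, |ζ i| := fun ζ =>
    Finset.single_le_sum (f := fun i => |ζ i|) (fun i _ => abs_nonneg _) (Finset.mem_univ i)
  have hG : ∀ ζ : ι → ℝ, |Real.exp (f (∑ i, (c i * ζ i) • a i)) *
      f' (∑ i, (c i * ζ i) • a i) (a i)| ≤ C * (K * ‖a i‖) * Real.exp (k * ∑ i, |ζ i|) := by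
    intro ζ
    rw [abs_mul, abs_of_nonneg (Real.exp_pos _).le]
    calc _ ≤ (C * Real.exp (k * ∑ i, |ζ i|)) * (K * ‖a i‖) :=
          mul_le_mul (hexp c hc ζ) (hb1 _ _) (abs_nonneg _) (by positivity)
      _ = _ := by ring
  refine ⟨?h2, ?h3, integral_eval_mul_gaussPi i (fun ζ s => ?_) ?_ ?h2 ?h3⟩
  · refine integrable_of_le_exp_sum_abs
      ((continuous_apply i).mul (hcx.mul hc1)).aestronglyMeasurable (C * (K * ‖a i‖)) (k + 1)
      fun ζ => ?_
    rw [abs_mul, add_mul, Real.exp_add, one_mul]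
    have h1 := (hr ζ).trans (Real.add_one_le_exp (∑ i, |ζ i|) |>.trans' (by linarith))
    calc _ ≤ Real.exp (∑ i, |ζ i|) * (C * (K * ‖a i‖) * Real.exp (k * ∑ i, |ζ i|)) :=
          mul_le_mul h1 (hG ζ) (abs_nonneg _) (Real.exp_pos _).le
      _ = _ := by ring
  · refine integrable_of_le_exp_sum_abs
      ((hcx.mul ((hc1.pow 2).add hc2)).const_mul (c i)).aestronglyMeasurable
      (C * ((K * ‖a i‖) ^ 2 + K * (‖a i‖ * ‖a i‖))) k fun ζ => ?_
    rw [abs_mul, abs_mul, abs_of_nonneg (Real.exp_pos _).le]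
    have h2 : |f' (∑ i, (c i * ζ i) • a i) (a i) ^ 2 + f'' (∑ i, (c i * ζ i) • a i) (a i) (a i)| ≤
        (K * ‖a i‖) ^ 2 + K * (‖a i‖ * ‖a i‖) := by
      refine (abs_add_le _ _).trans (add_le_add ?_ (hb2 _ _ _))
      rw [abs_pow]
      exact pow_le_pow_left₀ (abs_nonneg _) (hb1 _ _) 2
    calc _ ≤ 1 * ((C * Real.exp (k * ∑ i, |ζ i|)) *
            ((K * ‖a i‖) ^ 2 + K * (‖a i‖ * ‖a i‖))) :=
          mul_le_mul (hc i) (mul_le_mul (hexp c hc ζ) h2 (abs_nonneg _) (by positivity))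
            (by positivity) zero_le_one
      _ = _ := by ring
  · set x := ∑ j, (c j * Function.update ζ i s j) • a j with hxdef
    -- Moving only the coordinate `i` moves the point along the line in direction `a i` at speed `c
    -- i`, so directional derivatives suffice.
    have hline : ∀ s', ∑ j, (c j * Function.update ζ i s' j) • a j =
        x + (c i * (s' - s)) • a i := by
      intro s'
      rw [hxdef, ← Finset.add_sum_erase _ _ (Finset.mem_univ i),
        ← Finset.add_sum_erase (Finset.univ) (fun j => (c j * Function.update ζ i s j) • a j)
          (Finset.mem_univ i), add_right_comm]
      simp only [Function.update_self]
      rw [← add_smul]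
      congr 1
      · congr 1; ring
      · refine Finset.sum_congr rfl fun j hj => ?_
        rw [Function.update_of_ne (Finset.ne_of_mem_erase hj),
          Function.update_of_ne (Finset.ne_of_mem_erase hj)]
    have hd := ((hf.hasDerivAt_comp_line x (a i)).exp).mul (hf.hasDerivAt_line x (a i) (a i))
    have haff : HasDerivAt (fun s' : ℝ => c i * (s' - s)) (c i) s := by
      simpa using ((hasDerivAt_id s).sub_const s).const_mul (c i)
    have h0 : c i * (s - s) = 0 := by ring
    -- The derivative along the line is known at parameter `0`, which is the value of `c i * (s' -
    -- s)` at `s' = s`.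
    rw [← h0] at hd
    have := hd.comp s haff
    simp only [hline]
    refine this.congr_deriv ?_
    simp
    ring
  · exact integrable_of_le_exp_sum_abs (hcx.mul hc1).aestronglyMeasurable _ k hG

/-- The derivative of a Gaussian exponential moment along a path of linear images of a standard
Gaussian vector. -/
theorem hasDerivAt_integral_exp (hf : BddC2 f f' f'') (a : ι → V) {c c' : ι → ℝ → ℝ}
    (hc : ∀ i θ, HasDerivAt (c i) (c' i θ) θ) (hb : ∀ i θ, |c i θ| ≤ 1)
    (hb' : ∀ i θ, |c' i θ| ≤ 1) (θ : ℝ) :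
    HasDerivAt (fun θ => ∫ ζ, Real.exp (f (∑ i, (c i θ * ζ i) • a i)) ∂gaussPi ι)
      (∫ ζ, Real.exp (f (∑ i, (c i θ * ζ i) • a i)) * ∑ i, c i θ * c' i θ *
        (f' (∑ i, (c i θ * ζ i) • a i) (a i) ^ 2 +
          f'' (∑ i, (c i θ * ζ i) • a i) (a i) (a i)) ∂gaussPi ι) θ := by
  obtain ⟨C, k, hC, hk, hexp⟩ := hf.exists_exp_le a
  obtain ⟨K, hK, hb1, -⟩ := hf.bound
  have hcont : ∀ θ, Continuous fun ζ : ι → ℝ => Real.exp (f (∑ i, (c i θ * ζ i) • a i)) :=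
    fun θ => Real.continuous_exp.comp (hf.continuous.comp (continuous_sum_mul_smul _ a))
  have hcont' : ∀ i θ, Continuous fun ζ : ι → ℝ => f' (∑ i, (c i θ * ζ i) • a i) (a i) :=
    fun i θ => (hf.continuous_fst (a i)).comp (continuous_sum_mul_smul _ a)
  have key := (hasDerivAt_integral_of_dominated_loc_of_deriv_le (μ := gaussPi ι) (x₀ := θ)
    (s := Set.univ) (F := fun θ ζ => Real.exp (f (∑ i, (c i θ * ζ i) • a i)))
    (F' := fun θ ζ => ∑ i, c' i θ * (ζ i * (Real.exp (f (∑ i, (c i θ * ζ i) • a i)) *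
      f' (∑ i, (c i θ * ζ i) • a i) (a i))))
    (bound := fun ζ => C * (∑ i, K * ‖a i‖) * Real.exp ((k + 1) * ∑ i, |ζ i|))
    Filter.univ_mem (.of_forall fun θ => (hcont θ).aestronglyMeasurable)
    (hf.integrable_exp_comp a fun i => hb i θ)
    (continuous_finsetSum _ fun i _ => ((continuous_apply i).mul
      ((hcont θ).mul (hcont' i θ))).const_mul _).aestronglyMeasurable
    (.of_forall fun ζ θ _ => ?_) ((integrable_exp_sum_abs_gaussPi _).const_mul _)
    (.of_forall fun ζ θ _ => ?_)).2
  · refine key.congr_deriv ?_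
    -- Integration by parts trades each factor `ζ i` for `c i θ` and a second-order expression.
    have h := fun i => hf.integral_eval_mul_exp a (fun i => hb i θ) i
    rw [integral_finsetSum _ fun i _ => (h i).1.const_mul _]
    rw [Finset.sum_congr rfl fun i _ => by
      rw [integral_const_mul, (h i).2.2, ← integral_const_mul]]
    rw [← integral_finsetSum _ fun i _ => (h i).2.1.const_mul (c' i θ)]
    refine integral_congr_ae (.of_forall fun ζ => ?_)
    simp only [Finset.mul_sum]
    exact Finset.sum_congr rfl fun i _ => by ring
  · rw [Real.norm_eq_abs]
    refine (Finset.abs_sum_le_sum_abs _ _).trans ?_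
    rw [Finset.mul_sum, Finset.sum_mul]
    refine Finset.sum_le_sum fun i _ => ?_
    rw [abs_mul, abs_mul, abs_mul, abs_of_nonneg (Real.exp_pos _).le, add_mul, Real.exp_add,
      one_mul]
    have hr : |ζ i| ≤ Real.exp (∑ i, |ζ i|) := by
      have h1 : |ζ i| ≤ ∑ i, |ζ i| := Finset.single_le_sum (f := fun i => |ζ i|)
        (fun i _ => abs_nonneg _) (Finset.mem_univ i)
      linarith [Real.add_one_le_exp (∑ i, |ζ i|)]
    calc _ ≤ 1 * (Real.exp (∑ i, |ζ i|) * (C * Real.exp (k * ∑ i, |ζ i|) * (K * ‖a i‖))) :=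
          mul_le_mul (hb' i θ) (mul_le_mul hr (mul_le_mul (hexp _ (fun i => hb i θ) ζ) (hb1 _ _)
            (abs_nonneg _) (by positivity)) (by positivity) (Real.exp_pos _).le)
            (by positivity) zero_le_one
      _ = _ := by ring
  · have h1 : HasDerivAt (fun θ => ∑ i, (c i θ * ζ i) • a i) (∑ i, (c' i θ * ζ i) • a i) θ :=
      HasDerivAt.fun_sum fun i _ => ((hc i θ).mul_const (ζ i)).smul_const (a i)
    refine ((hf.hasFDerivAt _).comp_hasDerivAt θ h1).exp.congr_deriv ?_
    simp only [Function.comp_apply, map_sum, map_smul, smul_eq_mul, Finset.mul_sum]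
    exact Finset.sum_congr rfl fun i _ => by ring

end BddC2

end Interpolation

/-! ### Comparison of two Gaussian vectors by interpolation -/

section Comparison

variable {V ι κ : Type*} [NormedAddCommGroup V] [NormedSpace ℝ V] [Fintype ι] [Fintype κ]

theorem integral_gaussPi_comp_injective {e : κ → ι} (he : Function.Injective e) {g : (κ → ℝ) → ℝ}
    (hg : Continuous g) : ∫ ζ, g (ζ ∘ e) ∂gaussPi ι = ∫ ζ, g ζ ∂gaussPi κ := by
  rw [← gaussPi_map_comp_injective he, integral_map _ hg.aestronglyMeasurable]
  exact (measurable_pi_iff.2 fun k => measurable_pi_apply (e k)).aemeasurable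

theorem sum_pi_single_smul [DecidableEq ι] (ζ : ι → ℝ) :
    ∑ i, ζ i • (Pi.single i 1 : ι → ℝ) = ζ := by
  ext j; simp [Finset.sum_apply, Pi.single_apply]

namespace BddC2

variable {f : V → ℝ} {f' : V → V →L[ℝ] ℝ} {f'' : V → V → V → ℝ}

/-- Comparison of the exponential moments of a function of two Gaussian vectors. -/
theorem integral_exp_le_of_sum_le (hf : BddC2 f f' f'') (a : ι → V) (b : κ → V) {R : ℝ}
    (h : ∀ z, ∑ i, (f' z (a i) ^ 2 + f'' z (a i) (a i)) -
      ∑ j, (f' z (b j) ^ 2 + f'' z (b j) (b j)) ≤ R) :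
    ∫ ζ, Real.exp (f (∑ i, ζ i • a i)) ∂gaussPi ι ≤
      Real.exp (R / 2) * ∫ ζ, Real.exp (f (∑ j, ζ j • b j)) ∂gaussPi κ := by
  let w : ι ⊕ κ → V := Sum.elim a b
  -- The path runs from the `b`-vector at `θ = 0` to the `a`-vector at `θ = π / 2`. The products `c
  -- * c'` are `± sin θ cos θ`, so the derivative of `ψ` contains exactly the difference bounded by
  -- `R`. Unlike square roots of time, these coefficients have bounded derivatives up to the
  -- endpoints.
  let c : ι ⊕ κ → ℝ → ℝ := Sum.elim (fun _ => Real.sin) fun _ => Real.cos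
  let c' : ι ⊕ κ → ℝ → ℝ := Sum.elim (fun _ => Real.cos) fun _ θ => -Real.sin θ
  have hc : ∀ i θ, HasDerivAt (c i) (c' i θ) θ := by
    rintro (i | i) θ
    · exact Real.hasDerivAt_sin θ
    · exact Real.hasDerivAt_cos θ
  have hb : ∀ i θ, |c i θ| ≤ 1 := by
    rintro (i | i) θ
    · exact Real.abs_sin_le_one θ
    · exact Real.abs_cos_le_one θ
  have hb' : ∀ i θ, |c' i θ| ≤ 1 := by
    rintro (i | i) θ
    · exact Real.abs_cos_le_one θ
    · simpa [c'] using Real.abs_sin_le_one θ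
  set ψ : ℝ → ℝ := fun θ => ∫ ζ, Real.exp (f (∑ i, (c i θ * ζ i) • w i)) ∂gaussPi (ι ⊕ κ) with hψ
  obtain ⟨ψ', hψ', hle⟩ : ∃ ψ' : ℝ → ℝ, (∀ θ, HasDerivAt ψ (ψ' θ) θ) ∧
      ∀ θ ∈ Set.Ioo 0 (Real.pi / 2), ψ' θ ≤ Real.sin θ * Real.cos θ * R * ψ θ := by
    refine ⟨_, fun θ => hf.hasDerivAt_integral_exp w hc hb hb' θ, fun θ hθ => ?_⟩
    have hs : 0 ≤ Real.sin θ * Real.cos θ :=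
      mul_nonneg (Real.sin_nonneg_of_nonneg_of_le_pi hθ.1.le (by linarith [hθ.2, Real.pi_pos]))
        (Real.cos_nonneg_of_neg_pi_div_two_le_of_le (by linarith [hθ.1, Real.pi_pos]) hθ.2.le)
    rw [hψ, ← integral_const_mul]
    refine integral_mono ?_ ((hf.integrable_exp_comp w fun i => hb i θ).const_mul _) fun ζ => ?_
    · refine (integrable_finsetSum Finset.univ fun i _ =>
        ((hf.integral_eval_mul_exp w (fun i => hb i θ) i).2.1.const_mul (c' i θ))).congr
        (.of_forall fun ζ => ?_)
      simp only [Finset.mul_sum]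
      exact Finset.sum_congr rfl fun i _ => by ring
    · simp only
      have := h (∑ i, (c i θ * ζ i) • w i)
      rw [Fintype.sum_sum_type (fun i => c i θ * c' i θ *
        (f' (∑ i, (c i θ * ζ i) • w i) (w i) ^ 2 +
          f'' (∑ i, (c i θ * ζ i) • w i) (w i) (w i)))]
      set z := ∑ i, (c i θ * ζ i) • w i
      simp only [c, c', w, Sum.elim_inl, Sum.elim_inr, ← Finset.mul_sum]
      have h2 := mul_le_mul_of_nonneg_left (mul_le_mul_of_nonneg_left this hs)
        (Real.exp_pos (f z)).le
      calc _ = _ := by ring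
        _ ≤ _ := h2
        _ = _ := by ring
  -- Grönwall's argument: the integrating factor of `ψ' ≤ R sin θ cos θ ψ`.
  set φ : ℝ → ℝ := fun θ => ψ θ * Real.exp (-(R * Real.sin θ ^ 2 / 2)) with hφ
  have hφ' : ∀ θ, HasDerivAt φ ((ψ' θ - Real.sin θ * Real.cos θ * R * ψ θ) *
      Real.exp (-(R * Real.sin θ ^ 2 / 2))) θ := by
    intro θ
    have h1 := (((((Real.hasDerivAt_sin θ).pow 2).const_mul R).div_const 2).neg).exp
    refine ((hψ' θ).mul h1).congr_deriv ?_
    simp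
    ring
  have hanti : AntitoneOn φ (Set.Icc 0 (Real.pi / 2)) := by
    refine antitoneOn_of_deriv_nonpos (convex_Icc _ _)
      (fun θ _ => (hφ' θ).continuousAt.continuousWithinAt)
      (fun θ _ => (hφ' θ).differentiableAt.differentiableWithinAt) fun θ hθ => ?_
    rw [interior_Icc] at hθ
    rw [(hφ' θ).deriv]
    exact mul_nonpos_of_nonpos_of_nonneg (by linarith [hle θ hθ]) (Real.exp_pos _).le
  have hpi := Real.pi_pos
  have hend := hanti (Set.left_mem_Icc.2 (by positivity)) (Set.right_mem_Icc.2 (by positivity))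
    (by positivity : (0 : ℝ) ≤ Real.pi / 2)
  have h1 : ψ (Real.pi / 2) = ∫ ζ, Real.exp (f (∑ i, ζ i • a i)) ∂gaussPi ι := by
    rw [← integral_gaussPi_comp_injective (e := (Sum.inl : ι → ι ⊕ κ)) Sum.inl_injective
      (g := fun ζ => Real.exp (f (∑ i, ζ i • a i)))
      (Real.continuous_exp.comp (hf.continuous.comp (by fun_prop)))]
    simp [hψ, c, w]
  have h0 : ψ 0 = ∫ ζ, Real.exp (f (∑ j, ζ j • b j)) ∂gaussPi κ := by
    rw [← integral_gaussPi_comp_injective (e := (Sum.inr : κ → ι ⊕ κ)) Sum.inr_injective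
      (g := fun ζ => Real.exp (f (∑ j, ζ j • b j)))
      (Real.continuous_exp.comp (hf.continuous.comp (by fun_prop)))]
    simp [hψ, c, w]
  simp only [hφ, h1, h0, Real.sin_pi_div_two, Real.sin_zero] at hend
  norm_num at hend
  rw [Real.exp_neg, mul_inv_le_iff₀ (Real.exp_pos _)] at hend
  linarith

end BddC2

end Comparison

/-! ### Gaussian concentration from decoupling -/

section Concentration

variable {κ A : Type*} [Fintype κ] [Fintype A] {F : (κ → ℝ) → ℝ} {F' : (κ → ℝ) → (κ → ℝ) →L[ℝ] ℝ}
  {F'' : (κ → ℝ) → (κ → ℝ) → (κ → ℝ) → ℝ}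

namespace BddC2

theorem integrable_exp (hF : BddC2 F F' F'') :
    Integrable (fun ζ => Real.exp (F ζ)) (gaussPi κ) := by
  classical
  simpa [sum_pi_single_smul] using hF.integrable_exp_comp (fun i => Pi.single i (1 : ℝ))
    (c := fun _ => 1) (by simp)

theorem integrable (hF : BddC2 F F' F'') : Integrable F (gaussPi κ) := by
  obtain ⟨K, hK, h⟩ := hF.abs_le
  refine integrable_of_le_exp_sum_abs hF.continuous.aestronglyMeasurable (|F 0| + K) 1 fun ζ => ?_
  have h1 : ‖ζ‖ ≤ ∑ i, |ζ i| := by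
    refine (pi_norm_le_iff_of_nonneg (Finset.sum_nonneg fun _ _ => abs_nonneg _)).2 fun i => ?_
    exact Finset.single_le_sum (f := fun i => |ζ i|) (fun i _ => abs_nonneg _) (Finset.mem_univ i)
  have h2 := Real.add_one_le_exp (∑ i, |ζ i|)
  have h3 : 0 ≤ ∑ i, |ζ i| := Finset.sum_nonneg fun _ _ => abs_nonneg _
  rw [one_mul]
  have h4 : K * ‖ζ‖ ≤ K * Real.exp (∑ i, |ζ i|) := mul_le_mul_of_nonneg_left (by linarith) hK
  have h5 : |F 0| * 1 ≤ |F 0| * Real.exp (∑ i, |ζ i|) :=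
    mul_le_mul_of_nonneg_left (by linarith) (abs_nonneg _)
  linarith [h ζ]

/-- A decoupling bound for linear combinations, with coefficients that sum to zero, of independent
copies of a function of a Gaussian vector. -/
theorem prod_integral_exp_le [DecidableEq κ] (hF : BddC2 F F' F'') {R : ℝ}
    (hR : ∀ z, ∑ i, F' z (Pi.single i 1) ^ 2 ≤ R) {c : A → ℝ} (hc : ∑ t, c t = 0) :
    ∏ t, ∫ ζ, Real.exp (c t * F ζ) ∂gaussPi κ ≤ Real.exp ((∑ t, c t ^ 2) * R / 2) := by
  classical
  -- Bilinearity of `F''` is not part of `BddC2`; the bound still makes it vanish at zero, as needed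
  -- for the copies left unmoved by `b (t, i)`.
  have hz : ∀ z, F'' z 0 0 = 0 := fun z => by
    obtain ⟨K, -, -, h⟩ := hF.bound
    simpa using h z 0 0
  have hf := BddC2.sum (T := A) (fun t => hF.comp
    (ContinuousLinearMap.proj (R := ℝ) (φ := fun _ : A => κ → ℝ) t)) c
  -- The directions `b` generate independent copies of the Gaussian vector and `a` generates
  -- identical copies. On identical copies `∑ c t * F` vanishes, so the right-hand integral is `1`.
  let b : A × κ → A → κ → ℝ := fun q => Pi.single q.1 (Pi.single q.2 1)
  let a : κ → A → κ → ℝ := fun i _ => Pi.single i 1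
  have h := hf.integral_exp_le_of_sum_le b a (R := (∑ t, c t ^ 2) * R) fun z => ?_
  · have hb : ∀ ζ : A × κ → ℝ, ∑ q, ζ q • b q = Function.curry ζ := fun ζ => by
      ext t i
      simp [b, Finset.sum_apply, Fintype.sum_prod_type, Pi.single_apply, Function.curry, apply_ite,
        ite_apply]
    have ha : ∀ ζ : κ → ℝ, ∑ i, ζ i • a i = fun _ => ζ := fun ζ => by
      ext t i
      simp [a, Finset.sum_apply, Pi.single_apply]
    simp only [hb, ha, ContinuousLinearMap.proj_apply, ← Finset.sum_mul, hc] at h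
    simp only [zero_mul, Real.exp_zero, integral_const, probReal_univ, smul_eq_mul, mul_one] at h
    rw [← integral_fintype_prod_eq_prod (fun t ζ => Real.exp (c t * F ζ)), ← gaussPi_map_curry,
      integral_map]
    · simpa only [Real.exp_sum] using h
    · exact measurable_curry.aemeasurable
    · refine Continuous.aestronglyMeasurable ?_
      exact continuous_finsetProd _ fun t _ => Real.continuous_exp.comp
        ((hF.continuous.comp (continuous_apply t)).const_mul _)
  · simp only [Fintype.sum_prod_type, sum_apply, smul_apply, ContinuousLinearMap.comp_apply,
      ContinuousLinearMap.proj_apply, smul_eq_mul]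
    have e1 : ∀ t i, ∑ s, c s * F' (z s) (b (t, i) s) = c t * F' (z t) (Pi.single i 1) := by
      intro t i
      rw [Finset.sum_eq_single t]
      · simp [b]
      · intro s _ hs; simp [b, Pi.single_eq_of_ne hs]
      · simp
    have e2 : ∀ t i, ∑ s, c s * F'' (z s) (b (t, i) s) (b (t, i) s) =
        c t * F'' (z t) (Pi.single i 1) (Pi.single i 1) := by
      intro t i
      rw [Finset.sum_eq_single t]
      · simp [b]
      · intro s _ hs; simp [b, Pi.single_eq_of_ne hs, hz]
      · simp
    -- The second-order sums agree for both families. Only squared gradients remain, and that of the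
    -- identical copies is dropped by sign.
    simp only [e1, e2, a, Finset.sum_add_distrib, mul_pow, ← Finset.mul_sum]
    rw [Finset.sum_comm (s := (Finset.univ : Finset κ))]
    simp only [← Finset.mul_sum]
    have h1 : ∑ t, c t ^ 2 * ∑ i, F' (z t) (Pi.single i 1) ^ 2 ≤ (∑ t, c t ^ 2) * R := by
      rw [Finset.sum_mul]
      exact Finset.sum_le_sum fun t _ => mul_le_mul_of_nonneg_left (hR _) (sq_nonneg _)
    have h2 : 0 ≤ ∑ i, (∑ t, c t * F' (z t) (Pi.single i 1)) ^ 2 :=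
      Finset.sum_nonneg fun _ _ => sq_nonneg _
    linarith

/-- Gaussian concentration, with the sharp constant. -/
theorem integral_exp_le [DecidableEq κ] (hF : BddC2 F F' F'') {R : ℝ}
    (hR : ∀ z, ∑ i, F' z (Pi.single i 1) ^ 2 ≤ R) :
    ∫ ζ, Real.exp (F ζ) ∂gaussPi κ ≤ Real.exp (∫ ζ, F ζ ∂gaussPi κ + R / 2) := by
  have key : ∀ k : ℕ, ∫ ζ, Real.exp (F ζ) ∂gaussPi κ ≤
      Real.exp (∫ ζ, F ζ ∂gaussPi κ + (1 + 1 / ((k : ℝ) + 1)) * R / 2) := by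
    intro k
    have hk : (0 : ℝ) < (k : ℝ) + 1 := by positivity
    have h := hF.prod_integral_exp_le hR
      -- One copy of weight `1` against `k + 1` copies of weight `-1 / (k + 1)`: the weights sum to
      -- zero and their squares to `1 + 1 / (k + 1)`, which tends to the sharp value `1`.
      (c := fun t : Option (Fin (k + 1)) => t.elim 1 fun _ => -(1 / ((k : ℝ) + 1)))
      (by rw [Fintype.sum_option]; simp; field_simp; ring)
    rw [Fintype.prod_option, Fintype.sum_option] at h
    simp only [Option.elim_none, Option.elim_some, Finset.prod_const, Finset.sum_const,
      Finset.card_univ, Fintype.card_fin, one_mul] at h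
    -- By Jensen, the product of the `k + 1` negative copies is at least `exp (-E F)`.
    have hJ : Real.exp (-(1 / ((k : ℝ) + 1)) * ∫ ζ, F ζ ∂gaussPi κ) ≤
        ∫ ζ, Real.exp (-(1 / ((k : ℝ) + 1)) * F ζ) ∂gaussPi κ := by
      rw [← integral_const_mul]
      exact convexOn_exp.map_integral_le Real.continuous_exp.continuousOn isClosed_univ (by simp)
        (hF.integrable.const_mul _) (hF.const_mul _).integrable_exp
    have hJ2 := pow_le_pow_left₀ (Real.exp_pos _).le hJ (k + 1)
    rw [← Real.exp_nat_mul] at hJ2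
    have h3 := (mul_le_mul_of_nonneg_left hJ2
      (integral_nonneg fun ζ => (Real.exp_pos (F ζ)).le)).trans h
    have e : ((k + 1 : ℕ) : ℝ) * (-(1 / ((k : ℝ) + 1)) * ∫ ζ, F ζ ∂gaussPi κ) =
        -∫ ζ, F ζ ∂gaussPi κ := by push_cast; field_simp
    rw [e, Real.exp_neg, mul_inv_le_iff₀ (Real.exp_pos _), ← Real.exp_add] at h3
    refine h3.trans (Real.exp_le_exp.2 (le_of_eq ?_))
    simp only [nsmul_eq_mul]
    push_cast
    field_simp
    ring
  have hlim : Filter.Tendsto (fun k : ℕ => Real.exp (∫ ζ, F ζ ∂gaussPi κ +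
      (1 + 1 / ((k : ℝ) + 1)) * R / 2)) Filter.atTop
      (nhds (Real.exp (∫ ζ, F ζ ∂gaussPi κ + (1 + 0) * R / 2))) :=
    (Real.continuous_exp.tendsto _).comp
      (((tendsto_one_div_add_atTop_nhds_zero_nat.const_add 1).mul_const R).div_const 2
        |>.const_add _)
  have := ge_of_tendsto' hlim key
  simpa using this

end BddC2

end Concentration

/-! ### Gordon's comparison for a soft minimum -/

namespace BddC2

variable {V : Type*} [NormedAddCommGroup V] [NormedSpace ℝ V]

theorem of_clm (L : V →L[ℝ] ℝ) : BddC2 (fun z => L z) (fun _ => L) (fun _ _ _ => 0) where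
  hasFDerivAt _ := L.hasFDerivAt
  hasDerivAt_line _ _ _ := hasDerivAt_const _ _
  bound := ⟨‖L‖, norm_nonneg _, fun _ a => L.le_opNorm a, fun _ a b => by
    simpa using mul_nonneg (norm_nonneg L) (mul_nonneg (norm_nonneg a) (norm_nonneg b))⟩
  continuous_fst _ := continuous_const
  continuous_snd _ _ := continuous_const

theorem add {f g : V → ℝ} {f' g' : V → V →L[ℝ] ℝ} {f'' g'' : V → V → V → ℝ} (hf : BddC2 f f' f'')
    (hg : BddC2 g g' g'') : BddC2 (fun z => f z + g z) (fun z => f' z + g' z)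
      (fun z a b => f'' z a b + g'' z a b) where
  hasFDerivAt z := (hf.hasFDerivAt z).add (hg.hasFDerivAt z)
  hasDerivAt_line z a b := (hf.hasDerivAt_line z a b).add (hg.hasDerivAt_line z a b)
  bound := by
    obtain ⟨K, hK, h1, h2⟩ := hf.bound
    obtain ⟨M, hM, h3, h4⟩ := hg.bound
    refine ⟨K + M, by positivity, fun z a => ?_, fun z a b => ?_⟩
    · rw [add_mul]
      exact (abs_add_le _ _).trans (add_le_add (h1 z a) (h3 z a))
    · rw [add_mul]
      exact (abs_add_le _ _).trans (add_le_add (h2 z a b) (h4 z a b))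
  continuous_fst a := (hf.continuous_fst a).add (hg.continuous_fst a)
  continuous_snd a b := (hf.continuous_snd a b).add (hg.continuous_snd a b)

end BddC2

section Gordon

variable {n p : ℕ} {T : Type*}

theorem real_inner_eq_sum (x y : EuclideanSpace ℝ (Fin p)) : inner ℝ x y = ∑ j, x j * y j := by
  simp [PiLp.inner_apply, mul_comm]

/-- The directions of a Gaussian matrix acting on the vectors `u v`. -/
noncomputable def matrixDir (u : T → EuclideanSpace ℝ (Fin p)) (q : Fin n × Fin p) (v : T) :
    EuclideanSpace ℝ (Fin n) × ℝ :=
  (u v q.2 • EuclideanSpace.single q.1 1, 0)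

/-- The directions of two Gaussian vectors, the second paired with the vectors `u v`. -/
noncomputable def vectorDir (u : T → EuclideanSpace ℝ (Fin p)) (k : Fin n ⊕ Fin p) (v : T) :
    EuclideanSpace ℝ (Fin n) × ℝ :=
  k.elim (fun i => (EuclideanSpace.single i 1, 0)) fun j => (0, u v j)

/-- The hessian of `smoothNorm` on the diagonal. -/
noncomputable def smoothNormHess (x a : EuclideanSpace ℝ (Fin n)) : ℝ :=
  inner ℝ a a / smoothNorm x - inner ℝ x a * inner ℝ x a / smoothNorm x ^ 3

theorem smoothNormHess_smul (x a : EuclideanSpace ℝ (Fin n)) (c : ℝ) :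
    smoothNormHess x (c • a) = c ^ 2 * smoothNormHess x a := by
  simp only [smoothNormHess, inner_smul_left, inner_smul_right, RCLike.conj_to_real]
  ring

theorem smoothNormHess_zero (x : EuclideanSpace ℝ (Fin n)) : smoothNormHess x 0 = 0 := by
  simp [smoothNormHess]

/-- The covariance of `⟨m_v, X u_v⟩` for a standard Gaussian matrix `X`. -/
theorem sum_matrixDir (u : T → EuclideanSpace ℝ (Fin p)) (m : T → EuclideanSpace ℝ (Fin n))
    (v w : T) :
    ∑ k, (inner ℝ (m v) (matrixDir u k v).1 + (matrixDir u k v).2) *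
      (inner ℝ (m w) (matrixDir u k w).1 + (matrixDir u k w).2) =
      inner ℝ (u v) (u w) * inner ℝ (m v) (m w) := by
  simp only [matrixDir, Fintype.sum_prod_type, inner_smul_right, EuclideanSpace.inner_single_right,
    RCLike.conj_to_real, one_mul, add_zero, real_inner_eq_sum, Finset.sum_mul_sum]
  rw [Finset.sum_comm]
  exact Finset.sum_congr rfl fun i _ => Finset.sum_congr rfl fun j _ => by ring

/-- The covariance of `⟨m_v, g⟩ + ⟨u_v, h⟩` for independent standard Gaussian vectors `g` and `h`.
-/
theorem sum_vectorDir (u : T → EuclideanSpace ℝ (Fin p)) (m : T → EuclideanSpace ℝ (Fin n))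
    (v w : T) :
    ∑ k, (inner ℝ (m v) (vectorDir u k v).1 + (vectorDir u k v).2) *
      (inner ℝ (m w) (vectorDir u k w).1 + (vectorDir u k w).2) =
      inner ℝ (m v) (m w) + inner ℝ (u v) (u w) := by
  simp [vectorDir, Fintype.sum_sum_type, real_inner_eq_sum]

/-- Both sides are the Laplacian of the smooth norm: the Hessian is quadratic and `∑ j, u v j ^ 2 =
1`. Hence the curvature of the norm cancels in the comparison. -/
theorem sum_hess_matrixDir {u : T → EuclideanSpace ℝ (Fin p)} (hu : ∀ v, ‖u v‖ = 1)
    (x : EuclideanSpace ℝ (Fin n)) (v : T) :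
    ∑ k, smoothNormHess x (matrixDir u k v).1 =
      ∑ k : Fin n ⊕ Fin p, smoothNormHess x (vectorDir u k v).1 := by
  have h : ∑ j, u v j ^ 2 = 1 := by
    rw [← EuclideanSpace.real_norm_sq_eq, hu, one_pow]
  simp [matrixDir, vectorDir, Fintype.sum_sum_type, Fintype.sum_prod_type, smoothNormHess_smul,
    smoothNormHess_zero, ← Finset.sum_mul, h]

variable [Fintype T]

theorem sum_sq_sum_mul {ι : Type*} [Fintype ι] (q : T → ℝ) (d : T → ι → ℝ) :
    ∑ k, (∑ v, q v * d v k) ^ 2 = ∑ v, ∑ w, q v * q w * ∑ k, d v k * d w k := by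
  simp only [sq, Finset.sum_mul_sum, Finset.mul_sum (Finset.univ : Finset ι)]
  rw [Finset.sum_comm]
  refine Finset.sum_congr rfl fun v _ => ?_
  rw [Finset.sum_comm]
  exact Finset.sum_congr rfl fun w _ => Finset.sum_congr rfl fun k _ => by ring

/-- The soft minimum over `v` of `‖x_v‖ + y_v`, multiplied by `-l`. -/
noncomputable def softMin (l β : ℝ) (z : T → EuclideanSpace ℝ (Fin n) × ℝ) : ℝ :=
  l / β * Real.log (∑ v, Real.exp (-β * (smoothNorm (z v).1 + (z v).2)))

theorem exists_bddC2_softMin_aux [Nonempty T] (l : ℝ) {β : ℝ} (hβ : 0 < β) :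
    ∃ f' f'', BddC2 (softMin (n := n) (T := T) l β) f' f'' ∧ ∀ z, ∃ q : T → ℝ, (∀ v, 0 ≤ q v) ∧
      ∑ v, q v = 1 ∧
      (∀ a, f' z a = -l * ∑ v, q v * (inner ℝ (smoothNormGrad (z v).1) (a v).1 + (a v).2)) ∧
      ∀ a, f'' z a a = -l * ∑ v, q v * smoothNormHess (z v).1 (a v).1 +
        l * β * ∑ v, q v * (inner ℝ (smoothNormGrad (z v).1) (a v).1 + (a v).2) ^ 2 -
        l * β * (∑ v, q v * (inner ℝ (smoothNormGrad (z v).1) (a v).1 + (a v).2)) ^ 2 := by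
  have hη := (BddC2.smoothNorm.comp (ContinuousLinearMap.fst ℝ (EuclideanSpace ℝ (Fin n)) ℝ)).add
    (BddC2.of_clm (ContinuousLinearMap.snd ℝ (EuclideanSpace ℝ (Fin n)) ℝ))
  have hf := (BddC2.logSumExp (fun v : T => hη.comp
    (ContinuousLinearMap.proj (R := ℝ) (φ := fun _ : T => EuclideanSpace ℝ (Fin n) × ℝ) v))
    (-β)).const_mul (l / β)
  refine ⟨_, _, hf, fun z => ⟨_, gibbs_nonneg (-β) fun v => smoothNorm (z v).1 + (z v).2,
    sum_gibbs _ _, fun a => ?_, fun a => ?_⟩⟩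
  · simp only [ContinuousLinearMap.proj_apply, ContinuousLinearMap.coe_fst',
      ContinuousLinearMap.coe_snd', smul_apply, sum_apply, ContinuousLinearMap.comp_apply,
      add_apply, innerSL_apply_apply, smul_eq_mul]
    field_simp
  · simp only [ContinuousLinearMap.proj_apply, ContinuousLinearMap.coe_fst',
      ContinuousLinearMap.coe_snd', ContinuousLinearMap.comp_apply,
      add_apply, innerSL_apply_apply, add_zero, smoothNormHess]
    simp only [sq]
    field_simp
    ring

/-- The data of `softMin` needed for the comparison of a Gaussian matrix with Gaussian vectors. -/
theorem exists_bddC2_softMin [Nonempty T] (u : T → EuclideanSpace ℝ (Fin p)) (hu : ∀ v, ‖u v‖ = 1)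
    {l β : ℝ} (hl : 0 ≤ l) (hlβ : l ≤ β) (hβ : 0 < β) :
    ∃ f' f'', BddC2 (softMin (n := n) (T := T) l β) f' f'' ∧
      (∀ z, ∑ k, f' z (vectorDir u k) ^ 2 ≤ 2 * l ^ 2) ∧
      ∀ z, ∑ k, (f' z (matrixDir u k) ^ 2 + f'' z (matrixDir u k) (matrixDir u k)) -
        ∑ k, (f' z (vectorDir u k) ^ 2 + f'' z (vectorDir u k) (vectorDir u k)) ≤ -l ^ 2 := by
  obtain ⟨f', f'', hf, hq⟩ := exists_bddC2_softMin_aux (n := n) (T := T) l hβ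
  refine ⟨f', f'', hf, fun z => ?_, fun z => ?_⟩ <;> obtain ⟨q, hq0, hq1, h1, h2⟩ := hq z
  all_goals
    set m : T → EuclideanSpace ℝ (Fin n) := fun v => smoothNormGrad (z v).1
    replace h1 : ∀ a, f' z a = -l * ∑ v, q v * (inner ℝ (m v) (a v).1 + (a v).2) := h1
    replace h2 : ∀ a, f'' z a a = -l * ∑ v, q v * smoothNormHess (z v).1 (a v).1 +
        l * β * ∑ v, q v * (inner ℝ (m v) (a v).1 + (a v).2) ^ 2 -
        l * β * (∑ v, q v * (inner ℝ (m v) (a v).1 + (a v).2)) ^ 2 := h2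
    have hm : ∀ v w, inner ℝ (m v) (m w) ≤ 1 := fun v w =>
      (real_inner_le_norm _ _).trans (mul_le_one₀ (norm_smoothNormGrad_le _) (norm_nonneg _)
        (norm_smoothNormGrad_le _))
    have huu : ∀ v w, inner ℝ (u v) (u w) ≤ 1 := fun v w =>
      (real_inner_le_norm _ _).trans (by simp [hu])
    have hqq : ∑ v, ∑ w, q v * q w = 1 := by
      rw [← Finset.sum_mul_sum, hq1, one_mul]
    have hB : ∑ k, (∑ v, q v * (inner ℝ (m v) (vectorDir u k v).1 + (vectorDir u k v).2)) ^ 2 =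
        ∑ v, ∑ w, q v * q w * (inner ℝ (m v) (m w) + inner ℝ (u v) (u w)) := by
      rw [sum_sq_sum_mul]
      simp only [sum_vectorDir]
  · simp only [h1, mul_pow, ← Finset.mul_sum]
    have : ∑ v, ∑ w, q v * q w * (inner ℝ (m v) (m w) + inner ℝ (u v) (u w)) ≤
        ∑ v, ∑ w, q v * q w * 2 :=
      Finset.sum_le_sum fun v _ => Finset.sum_le_sum fun w _ =>
        mul_le_mul_of_nonneg_left (by linarith [hm v w, huu v w]) (mul_nonneg (hq0 v) (hq0 w))
    simp only [← Finset.sum_mul, hqq] at this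
    rw [hB]
    nlinarith [sq_nonneg l]
  · have hA : ∑ k, (∑ v, q v * (inner ℝ (m v) (matrixDir u k v).1 + (matrixDir u k v).2)) ^ 2 =
        ∑ v, ∑ w, q v * q w * (inner ℝ (u v) (u w) * inner ℝ (m v) (m w)) := by
      rw [sum_sq_sum_mul]
      simp only [sum_matrixDir]
    have hA2 : ∑ k, ∑ v, q v * (inner ℝ (m v) (matrixDir u k v).1 + (matrixDir u k v).2) ^ 2 =
        ∑ v, q v * inner ℝ (m v) (m v) := by
      rw [Finset.sum_comm]
      refine Finset.sum_congr rfl fun v _ => ?_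
      simp only [sq, ← Finset.mul_sum, sum_matrixDir, real_inner_self_eq_norm_mul_norm (u v), hu,
        one_mul]
    have hB2 : ∑ k, ∑ v, q v * (inner ℝ (m v) (vectorDir u k v).1 + (vectorDir u k v).2) ^ 2 =
        ∑ v, q v * inner ℝ (m v) (m v) + 1 := by
      rw [Finset.sum_comm, ← hq1, ← Finset.sum_add_distrib]
      refine Finset.sum_congr rfl fun v _ => ?_
      simp only [sq, ← Finset.mul_sum, sum_vectorDir, real_inner_self_eq_norm_mul_norm (u v), hu]
      ring
    have hH : ∑ k, ∑ v, q v * smoothNormHess (z v).1 (matrixDir u k v).1 =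
        ∑ k : Fin n ⊕ Fin p, ∑ v, q v * smoothNormHess (z v).1 (vectorDir u k v).1 := by
      rw [Finset.sum_comm]
      conv_rhs => rw [Finset.sum_comm]
      simp only [← Finset.mul_sum, sum_hess_matrixDir hu]
    -- Gordon's inequality, averaged over two independent Gibbs samples; only `‖m v‖ ≤ 1` is
    -- available for the smooth gradients, and it is enough.
    have hpos : 0 ≤ ∑ v, ∑ w, q v * q w *
        ((1 - inner ℝ (u v) (u w)) * (1 - inner ℝ (m v) (m w))) :=
      Finset.sum_nonneg fun v _ => Finset.sum_nonneg fun w _ => mul_nonneg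
        (mul_nonneg (hq0 v) (hq0 w))
        (mul_nonneg (by linarith [huu v w]) (by linarith [hm v w]))
    have hexp : ∑ v, ∑ w, q v * q w * ((1 - inner ℝ (u v) (u w)) * (1 - inner ℝ (m v) (m w))) =
        1 - ∑ v, ∑ w, q v * q w * (inner ℝ (m v) (m w) + inner ℝ (u v) (u w)) +
          ∑ v, ∑ w, q v * q w * (inner ℝ (u v) (u w) * inner ℝ (m v) (m w)) := by
      conv_rhs => enter [1, 1]; rw [← hqq]
      rw [← Finset.sum_sub_distrib, ← Finset.sum_add_distrib]
      refine Finset.sum_congr rfl fun v _ => ?_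
      rw [← Finset.sum_sub_distrib, ← Finset.sum_add_distrib]
      exact Finset.sum_congr rfl fun w _ => by ring
    simp only [h1, h2, mul_pow, Finset.sum_add_distrib, Finset.sum_sub_distrib, ← Finset.mul_sum,
      hA, hA2, hB, hB2, hH]
    rw [hexp] at hpos
    -- If `A` and `B` are the averaged covariances of the matrix and vector processes, the left side
    -- equals `-l (β - l) (A - B) - l β`. Since `A - B ≥ -1` and `l ≤ β`, it is at most `-l²`.
    nlinarith [mul_nonneg (mul_nonneg hl (sub_nonneg.2 hlβ)) hpos]

/-- A Gaussian matrix compared with a pair of Gaussian vectors, with concentration. -/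
theorem integral_exp_softMin_le [Nonempty T] (u : T → EuclideanSpace ℝ (Fin p))
    (hu : ∀ v, ‖u v‖ = 1) {l β : ℝ} (hl : 0 ≤ l) (hlβ : l ≤ β) (hβ : 0 < β) :
    ∫ ζ, Real.exp (softMin l β (∑ k, ζ k • matrixDir u k)) ∂gaussPi (Fin n × Fin p) ≤
      Real.exp (∫ ζ, softMin l β (∑ k, ζ k • vectorDir u k) ∂gaussPi (Fin n ⊕ Fin p) +
        l ^ 2 / 2) := by
  obtain ⟨f', f'', hf, hR, hle⟩ := exists_bddC2_softMin (n := n) u hu hl hlβ hβ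
  have h1 := hf.integral_exp_le_of_sum_le (matrixDir u) (vectorDir u) hle
  let L : (Fin n ⊕ Fin p → ℝ) →L[ℝ] (T → EuclideanSpace ℝ (Fin n) × ℝ) :=
    ∑ k, (ContinuousLinearMap.proj (R := ℝ) (φ := fun _ : Fin n ⊕ Fin p => ℝ) k).smulRight
      (vectorDir u k)
  have hL : ∀ ζ, L ζ = ∑ k, ζ k • vectorDir u k := fun ζ => by simp [L, sum_apply]
  have hL1 : ∀ k, L (Pi.single k 1) = vectorDir u k := fun k => by
    simp [hL, Pi.single_apply]
  have h2 := (hf.comp L).integral_exp_le (R := 2 * l ^ 2) fun z => by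
    simpa [hL1] using hR (L z)
  simp only [hL] at h2
  -- Comparison contributes `-l² / 2` to the exponent and concentration `2 l² / 2`.
  refine (h1.trans (mul_le_mul_of_nonneg_left h2 (Real.exp_pos _).le)).trans (le_of_eq ?_)
  rw [← Real.exp_add]
  congr 1
  ring

end Gordon

/-! ### Moments of the norm of a Gaussian vector -/

section Moments

variable {ι : Type*} [Fintype ι]

theorem abs_le_sum_abs (ζ : ι → ℝ) (i : ι) : |ζ i| ≤ ∑ i, |ζ i| :=
  Finset.single_le_sum (f := fun i => |ζ i|) (fun _ _ => abs_nonneg _) (Finset.mem_univ i)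

theorem sum_sq_le_sq_sum_abs (ζ : ι → ℝ) : ∑ i, ζ i ^ 2 ≤ (∑ i, |ζ i|) ^ 2 := by
  simpa using Finset.sum_sq_le_sq_sum_of_nonneg (s := Finset.univ) (f := fun i => |ζ i|)
    fun i _ => abs_nonneg (ζ i)

theorem integrable_of_le_pow_sum_abs {G : (ι → ℝ) → ℝ} (hG : Continuous G) (C : ℝ) (k : ℕ)
    (h : ∀ ζ, |G ζ| ≤ C * (∑ i, |ζ i|) ^ k) : Integrable G (gaussPi ι) := by
  refine integrable_of_le_exp_sum_abs hG.aestronglyMeasurable (|C| * k.factorial) 1 fun ζ => ?_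
  have h0 : 0 ≤ ∑ i, |ζ i| := Finset.sum_nonneg fun _ _ => abs_nonneg _
  have h1 := Real.pow_div_factorial_le_exp _ h0 k
  rw [div_le_iff₀ (by positivity)] at h1
  calc |G ζ| ≤ |C| * (∑ i, |ζ i|) ^ k :=
        (h ζ).trans (mul_le_mul_of_nonneg_right (le_abs_self C) (by positivity))
    _ ≤ |C| * (Real.exp (∑ i, |ζ i|) * k.factorial) :=
        mul_le_mul_of_nonneg_left h1 (abs_nonneg C)
    _ = _ := by rw [one_mul]; ring

theorem integral_sum_sq_gaussPi : ∫ ζ, ∑ i, ζ i ^ 2 ∂gaussPi ι = Fintype.card ι := by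
  classical
  have hi : ∀ i : ι, Integrable (fun ζ : ι → ℝ => ζ i * ζ i) (gaussPi ι) := fun i => by
    refine integrable_of_le_pow_sum_abs (by fun_prop) 1 2 fun ζ => ?_
    rw [abs_mul, one_mul, sq]
    exact mul_le_mul (abs_le_sum_abs ζ i) (abs_le_sum_abs ζ i) (abs_nonneg _)
      ((abs_nonneg _).trans (abs_le_sum_abs ζ i))
  have h : ∀ i : ι, ∫ ζ : ι → ℝ, ζ i * ζ i ∂gaussPi ι = 1 := fun i => by
    rw [integral_eval_mul_gaussPi i (G := fun ζ => ζ i) (G' := fun _ => 1)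
      (fun ζ s => by simpa using hasDerivAt_id' s)
      (integrable_of_le_pow_sum_abs (by fun_prop) 1 1 fun ζ => by
        simpa using abs_le_sum_abs ζ i) (hi i) (integrable_const _)]
    simp
  simp only [sq]
  rw [integral_finsetSum _ fun i _ => hi i]
  simp [h]

theorem integrable_sum_sq_gaussPi : Integrable (fun ζ : ι → ℝ => ∑ i, ζ i ^ 2) (gaussPi ι) :=
  integrable_of_le_pow_sum_abs (by fun_prop) 1 2 fun ζ => by
    rw [abs_of_nonneg (Finset.sum_nonneg fun _ _ => sq_nonneg _), one_mul]
    exact sum_sq_le_sq_sum_abs ζ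

theorem integrable_sq_sum_sq_gaussPi :
    Integrable (fun ζ : ι → ℝ => (∑ i, ζ i ^ 2) ^ 2) (gaussPi ι) :=
  integrable_of_le_pow_sum_abs (by fun_prop) 1 4 fun ζ => by
    rw [abs_of_nonneg (sq_nonneg _), one_mul]
    calc _ ≤ ((∑ i, |ζ i|) ^ 2) ^ 2 :=
          pow_le_pow_left₀ (Finset.sum_nonneg fun _ _ => sq_nonneg _) (sum_sq_le_sq_sum_abs ζ) 2
      _ = _ := by ring

/-- Integration by parts of `ζ i * (ζ i * ‖ζ‖²)` gives `E [‖ζ‖² + 2 ζ i²]`; summing over `i` leaves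
only second moments. -/
theorem integral_sq_sum_sq_gaussPi :
    ∫ ζ, (∑ i, ζ i ^ 2) ^ 2 ∂gaussPi ι = Fintype.card ι * (Fintype.card ι + 2) := by
  classical
  have hi : ∀ i : ι, Integrable (fun ζ : ι → ℝ => ζ i * (ζ i * ∑ j, ζ j ^ 2)) (gaussPi ι) :=
    fun i => integrable_of_le_pow_sum_abs (by fun_prop) 1 4 fun ζ => by
      have h0 : 0 ≤ ∑ i, |ζ i| := Finset.sum_nonneg fun _ _ => abs_nonneg _
      rw [abs_mul, abs_mul, abs_of_nonneg (Finset.sum_nonneg fun j _ => sq_nonneg (ζ j))]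
      calc _ ≤ (∑ i, |ζ i|) * ((∑ i, |ζ i|) * (∑ i, |ζ i|) ^ 2) :=
            mul_le_mul (abs_le_sum_abs ζ i) (mul_le_mul (abs_le_sum_abs ζ i)
              (sum_sq_le_sq_sum_abs ζ) (Finset.sum_nonneg fun j _ => sq_nonneg (ζ j)) h0)
              (mul_nonneg (abs_nonneg _) (Finset.sum_nonneg fun j _ => sq_nonneg (ζ j))) h0
        _ = _ := by ring
  have hsq : ∀ i : ι, Integrable (fun ζ : ι → ℝ => ζ i ^ 2) (gaussPi ι) := fun i =>
    integrable_of_le_pow_sum_abs (by fun_prop) 1 2 fun ζ => by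
      rw [abs_pow, one_mul]
      exact pow_le_pow_left₀ (abs_nonneg _) (abs_le_sum_abs ζ i) 2
  have h : ∀ i : ι, ∫ ζ : ι → ℝ, ζ i * (ζ i * ∑ j, ζ j ^ 2) ∂gaussPi ι =
      ∫ ζ : ι → ℝ, (∑ j, ζ j ^ 2 + 2 * ζ i ^ 2) ∂gaussPi ι := fun i => by
    refine integral_eval_mul_gaussPi i (G := fun ζ => ζ i * ∑ j, ζ j ^ 2)
      (G' := fun ζ => ∑ j, ζ j ^ 2 + 2 * ζ i ^ 2) (fun ζ s => ?_) ?_ (hi i)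
      (integrable_sum_sq_gaussPi.add ((hsq i).const_mul 2))
    · have e : ∀ s, ∑ j, Function.update ζ i s j ^ 2 =
          s ^ 2 + ∑ j ∈ Finset.univ.erase i, ζ j ^ 2 := fun s => by
        rw [← Finset.add_sum_erase _ _ (Finset.mem_univ i), Function.update_self]
        congr 1
        refine Finset.sum_congr rfl fun j hj => ?_
        rw [Function.update_of_ne (Finset.ne_of_mem_erase hj)]
      simp only [e, Function.update_self]
      refine ((hasDerivAt_id s).mul ((hasDerivAt_pow 2 s).add_const _)).congr_deriv ?_
      simp
      ring
    · exact integrable_of_le_pow_sum_abs (by fun_prop) 1 3 fun ζ => by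
        have h0 : 0 ≤ ∑ i, |ζ i| := Finset.sum_nonneg fun _ _ => abs_nonneg _
        rw [abs_mul, abs_of_nonneg (Finset.sum_nonneg fun j _ => sq_nonneg (ζ j))]
        calc _ ≤ (∑ i, |ζ i|) * (∑ i, |ζ i|) ^ 2 :=
              mul_le_mul (abs_le_sum_abs ζ i) (sum_sq_le_sq_sum_abs ζ)
                (Finset.sum_nonneg fun j _ => sq_nonneg (ζ j)) h0
          _ = _ := by ring
  have e : ∀ ζ : ι → ℝ, (∑ i, ζ i ^ 2) ^ 2 = ∑ i, ζ i * (ζ i * ∑ j, ζ j ^ 2) := fun ζ => by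
    simp only [← mul_assoc, ← sq, ← Finset.sum_mul]
  simp only [e]
  rw [integral_finsetSum _ fun i _ => hi i]
  simp only [h]
  rw [← integral_finsetSum (f := fun (i : ι) (ζ : ι → ℝ) => ∑ j, ζ j ^ 2 + 2 * ζ i ^ 2) _
    fun i _ => integrable_sum_sq_gaussPi.add ((hsq i).const_mul 2)]
  simp only [Finset.sum_add_distrib, Finset.sum_const, ← Finset.mul_sum, Finset.card_univ,
    nsmul_eq_mul]
  rw [integral_add (integrable_sum_sq_gaussPi.const_mul _) (integrable_sum_sq_gaussPi.const_mul _),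
    integral_const_mul, integral_const_mul, integral_sum_sq_gaussPi]
  ring

/-- A lower bound for the mean norm of a standard Gaussian vector. -/
theorem le_integral_smoothNorm {n : ℕ} (hn : 0 < n) : √n - 1 / √n ≤
    ∫ ζ, smoothNorm (WithLp.toLp 2 ζ : EuclideanSpace ℝ (Fin n)) ∂gaussPi (Fin n) := by
  have hn' : (0 : ℝ) < n := by exact_mod_cast hn
  have hs : 0 < √(n : ℝ) := Real.sqrt_pos.2 hn'
  have hs2 : √(n : ℝ) ^ 2 = n := Real.sq_sqrt hn'.le
  have hpt : ∀ ζ : Fin n → ℝ, √n * (3 / 2 * ((∑ i, ζ i ^ 2) / n) -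
      (∑ i, ζ i ^ 2) ^ 2 / (2 * n ^ 2)) ≤
      smoothNorm (WithLp.toLp 2 ζ : EuclideanSpace ℝ (Fin n)) := fun ζ => by
    refine le_trans ?_ (norm_le_smoothNorm _)
    set x := ‖(WithLp.toLp 2 ζ : EuclideanSpace ℝ (Fin n))‖ with hx
    have hx0 : 0 ≤ x := norm_nonneg _
    have hx2 : ∑ i, ζ i ^ 2 = x ^ 2 := by
      rw [hx, EuclideanSpace.real_norm_sq_eq]
    obtain ⟨t, ht⟩ : ∃ t, t = x / √(n : ℝ) := ⟨_, rfl⟩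
    have hxt : x = t * √(n : ℝ) := by rw [ht]; field_simp
    have ht0 : 0 ≤ t := by rw [ht]; positivity
    rw [hx2, hxt, mul_pow, hs2]
    -- This is twice `t - (3 / 2) t² + t⁴ / 2`, a polynomial lower bound for `t` tangent at `t = 1`;
    -- it needs only the second and fourth moments.
    have : 0 ≤ t * (t - 1) ^ 2 * (t + 2) := by positivity
    field_simp
    nlinarith
  have hi : Integrable (fun ζ : Fin n → ℝ => √n * (3 / 2 * ((∑ i, ζ i ^ 2) / n) -
      (∑ i, ζ i ^ 2) ^ 2 / (2 * n ^ 2))) (gaussPi (Fin n)) :=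
    (((integrable_sum_sq_gaussPi.div_const _).const_mul _).sub
      (integrable_sq_sum_sq_gaussPi.div_const _)).const_mul _
  have hN : Integrable (fun ζ => smoothNorm (WithLp.toLp 2 ζ : EuclideanSpace ℝ (Fin n)))
      (gaussPi (Fin n)) :=
    (BddC2.smoothNorm.comp
      (PiLp.continuousLinearEquiv 2 ℝ (fun _ : Fin n => ℝ)).symm.toContinuousLinearMap).integrable
  refine le_trans (le_of_eq ?_) (integral_mono hi hN hpt)
  rw [integral_const_mul, integral_sub ((integrable_sum_sq_gaussPi.div_const _).const_mul _)
    (integrable_sq_sum_sq_gaussPi.div_const _), integral_const_mul, integral_div, integral_div,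
    integral_sum_sq_gaussPi, integral_sq_sum_sq_gaussPi, Fintype.card_fin]
  field_simp
  rw [hs2]
  ring

end Moments

/-! ### Gaussian width and the support function -/

section Width

variable {p : ℕ}

theorem norm_le_l1norm (v : EuclideanSpace ℝ (Fin p)) : ‖v‖ ≤ l1norm v := by
  conv_lhs => rw [← (EuclideanSpace.basisFun (Fin p) ℝ).sum_repr v]
  refine (norm_sum_le _ _).trans (le_of_eq ?_)
  simp [l1norm, norm_smul]

theorem l1norm_smul (c : ℝ) (v : EuclideanSpace ℝ (Fin p)) : l1norm (c • v) = |c| * l1norm v := by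
  simp [l1norm, abs_mul, Finset.mul_sum]

theorem mulEuclid_eq (M : Matrix (Fin p) (Fin p) ℝ) (v : EuclideanSpace ℝ (Fin p)) :
    mulEuclid M v = Matrix.toEuclideanCLM (𝕜 := ℝ) M v := rfl

theorem exists_norm_le_of_mem_image_l1ball (M : Matrix (Fin p) (Fin p) ℝ) :
    ∃ K : NNReal, ∀ b ∈ mulEuclid M '' l1ball p, ‖b‖ ≤ K := by
  refine ⟨‖Matrix.toEuclideanCLM (𝕜 := ℝ) M‖₊, ?_⟩
  rintro _ ⟨v, hv, rfl⟩
  rw [mulEuclid_eq]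
  refine ((Matrix.toEuclideanCLM (𝕜 := ℝ) M).le_opNorm v).trans ?_
  exact mul_le_of_le_one_right (norm_nonneg _) ((norm_le_l1norm v).trans hv)

/-- The support function of `B`. -/
noncomputable def supportFun (B : Set (EuclideanSpace ℝ (Fin p))) (ξ : EuclideanSpace ℝ (Fin p)) :
    ℝ :=
  sSup ((fun b => inner ℝ b ξ) '' B)

variable {B : Set (EuclideanSpace ℝ (Fin p))} {K : NNReal}

theorem inner_le_supportFun (hK : ∀ b ∈ B, ‖b‖ ≤ K) {b : EuclideanSpace ℝ (Fin p)} (hb : b ∈ B)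
    (ξ : EuclideanSpace ℝ (Fin p)) : inner ℝ b ξ ≤ supportFun B ξ := by
  refine le_csSup ⟨K * ‖ξ‖, ?_⟩ ⟨b, hb, rfl⟩
  rintro _ ⟨c, hc, rfl⟩
  exact (real_inner_le_norm c ξ).trans (mul_le_mul_of_nonneg_right (hK c hc) (norm_nonneg _))

theorem lipschitzWith_supportFun (hK : ∀ b ∈ B, ‖b‖ ≤ K) (hB : B.Nonempty) :
    LipschitzWith K (supportFun B) := by
  refine LipschitzWith.of_le_add_mul K fun ξ ξ' => csSup_le (hB.image _) ?_
  rintro _ ⟨b, hb, rfl⟩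
  have h1 : inner ℝ b ξ = inner ℝ b ξ' + inner ℝ b (ξ - ξ') := by rw [← inner_add_right]; simp
  have h2 := (real_inner_le_norm b (ξ - ξ')).trans
    (mul_le_mul_of_nonneg_right (hK b hb) (norm_nonneg _))
  have h3 := inner_le_supportFun hK hb ξ'
  rw [dist_eq_norm]
  simp only [h1]
  linarith

theorem continuous_supportFun_toLp (hK : ∀ b ∈ B, ‖b‖ ≤ K) (hB : B.Nonempty) :
    Continuous fun ζ : Fin p → ℝ => supportFun B (WithLp.toLp 2 ζ) :=
  (lipschitzWith_supportFun hK hB).continuous.comp (PiLp.continuous_toLp 2 _)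

theorem integrable_supportFun (hK : ∀ b ∈ B, ‖b‖ ≤ K) (hB : B.Nonempty) :
    Integrable (fun ζ => supportFun B (WithLp.toLp 2 ζ)) (gaussPi (Fin p)) := by
  have h0 : supportFun B 0 = 0 := by
    simp [supportFun, hB.image_const]
  refine integrable_of_le_pow_sum_abs (continuous_supportFun_toLp hK hB) K 1 fun ζ => ?_
  have h1 := (lipschitzWith_supportFun hK hB).dist_le_mul (WithLp.toLp 2 ζ) 0
  rw [h0, Real.dist_0_eq_abs, dist_zero_right] at h1
  refine h1.trans (mul_le_mul_of_nonneg_left ?_ K.2)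
  simpa [l1norm] using norm_le_l1norm (WithLp.toLp 2 ζ : EuclideanSpace ℝ (Fin p))

theorem integral_supportFun (hK : ∀ b ∈ B, ‖b‖ ≤ K) (hB : B.Nonempty) :
    ∫ ζ, supportFun B (WithLp.toLp 2 ζ) ∂gaussPi (Fin p) = gaussianWidth B := by
  rw [gaussianWidth, ← map_pi_eq_stdGaussian, integral_map]
  · rfl
  · exact (PiLp.continuous_toLp 2 _).measurable.aemeasurable
  · exact (lipschitzWith_supportFun hK hB).continuous.aestronglyMeasurable

theorem zero_mem_l1ball : (0 : EuclideanSpace ℝ (Fin p)) ∈ l1ball p := by simp [l1ball, l1norm]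

/-- By symmetry of the `ℓ¹` ball, `-v / r` belongs to it. -/
theorem neg_inner_le_supportFun {M : Matrix (Fin p) (Fin p) ℝ}
    (hK : ∀ b ∈ mulEuclid M '' l1ball p, ‖b‖ ≤ K) {r : ℝ} (hr : 0 < r)
    {v : EuclideanSpace ℝ (Fin p)} (hv : l1norm v ≤ r) (ξ : EuclideanSpace ℝ (Fin p)) :
    -inner ℝ (mulEuclid M v) ξ ≤ r * supportFun (mulEuclid M '' l1ball p) ξ := by
  have hmem : (-r⁻¹) • v ∈ l1ball p := by
    rw [l1ball, Set.mem_ofPred_eq, l1norm_smul, abs_neg, abs_of_pos (inv_pos.2 hr),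
      inv_mul_le_iff₀ hr, mul_one]
    exact hv
  have := inner_le_supportFun hK (Set.mem_image_of_mem _ hmem) ξ
  rw [mulEuclid_eq, map_smul, inner_smul_left, ← mulEuclid_eq] at this
  simp only [RCLike.conj_to_real] at this
  calc -inner ℝ (mulEuclid M v) ξ = r * (-r⁻¹ * inner ℝ (mulEuclid M v) ξ) := by field_simp
    _ ≤ _ := mul_le_mul_of_nonneg_left this hr.le

end Width

/-! ### Lower tail for finitely many vectors of bounded `ℓ¹` norm -/

section Level

variable {n p : ℕ} {T : Type*}

theorem sum_smul_vectorDir (u : T → EuclideanSpace ℝ (Fin p)) (ζ : Fin n ⊕ Fin p → ℝ) (v : T) :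
    (∑ k, ζ k • vectorDir u k) v =
      (WithLp.toLp 2 (ζ ∘ Sum.inl), inner ℝ (u v) (WithLp.toLp 2 (ζ ∘ Sum.inr))) := by
  refine Prod.ext ?_ ?_
  · ext i
    simp [Finset.sum_apply, Prod.fst_sum, vectorDir, Pi.single_apply]
  · simp [Finset.sum_apply, Prod.snd_sum, vectorDir, real_inner_eq_sum, mul_comm]

theorem sum_smul_matrixDir (u : T → EuclideanSpace ℝ (Fin p)) (ζ : Fin n × Fin p → ℝ) (v : T) :
    (∑ k, ζ k • matrixDir u k) v =
      (WithLp.toLp 2 fun i => inner ℝ (WithLp.toLp 2 (Function.curry ζ i)) (u v), 0) := by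
  refine Prod.ext ?_ ?_
  · ext i
    simp [Finset.sum_apply, Prod.fst_sum, matrixDir, Pi.single_apply, Fintype.sum_prod_type,
      real_inner_eq_sum, Function.curry]
  · simp [Finset.sum_apply, Prod.snd_sum, matrixDir]

variable [Fintype T]

theorem softMin_le {l β : ℝ} (hl : 0 ≤ l) (hβ : 0 < β) [Nonempty T]
    {z : T → EuclideanSpace ℝ (Fin n) × ℝ} {c : ℝ} (h : ∀ v, c ≤ smoothNorm (z v).1 + (z v).2) :
    softMin l β z ≤ l * (Real.log (Fintype.card T) / β - c) := by
  have hm : (0 : ℝ) < Fintype.card T := by exact_mod_cast Fintype.card_pos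
  have h1 : ∑ v, Real.exp (-β * (smoothNorm (z v).1 + (z v).2)) ≤
      Fintype.card T * Real.exp (-β * c) := by
    refine (Finset.sum_le_card_nsmul _ _ (Real.exp (-β * c)) fun v _ => ?_).trans
      (by simp [Finset.card_univ])
    exact Real.exp_le_exp.2 (by nlinarith [h v])
  have h2 := Real.log_le_log (sum_exp_pos (-β) _) h1
  rw [Real.log_mul hm.ne' (Real.exp_pos _).ne', Real.log_exp] at h2
  calc softMin l β z ≤ l / β * (Real.log (Fintype.card T) + -β * c) :=
        mul_le_mul_of_nonneg_left h2 (by positivity)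
    _ = _ := by field_simp; ring

theorem le_softMin {l β : ℝ} (hl : 0 ≤ l) (hβ : 0 < β)
    (z : T → EuclideanSpace ℝ (Fin n) × ℝ) (v : T) :
    -l * (smoothNorm (z v).1 + (z v).2) ≤ softMin l β z := by
  have h1 := Finset.single_le_sum
    (f := fun v => Real.exp (-β * (smoothNorm (z v).1 + (z v).2)))
    (fun v _ => (Real.exp_pos _).le) (Finset.mem_univ v)
  have h2 := Real.log_le_log (Real.exp_pos _) h1
  rw [Real.log_exp] at h2
  calc _ = l / β * (-β * (smoothNorm (z v).1 + (z v).2)) := by field_simp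
    _ ≤ _ := mul_le_mul_of_nonneg_left h2 (by positivity)

/-- Pointwise, every `‖g‖ + ⟨u, h⟩` is at least `‖g‖` minus `r` times the support function at `h`.
Taking means yields `√n`, the width, and the loss `1 / √n ≤ 0.1`, which is where `n ≥ 100` enters.
-/
theorem integral_softMin_vectorDir_le [Nonempty T] (hn : 100 ≤ n) {M : Matrix (Fin p) (Fin p) ℝ}
    {v : T → EuclideanSpace ℝ (Fin p)} (hu : ∀ t, ‖mulEuclid M (v t)‖ = 1) {r : ℝ} (hr : 0 < r)
    (hv : ∀ t, l1norm (v t) ≤ r) {l β : ℝ} (hl : 0 ≤ l) (hlβ : l ≤ β) (hβ : 0 < β) :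
    ∫ ζ, softMin l β (∑ k, ζ k • vectorDir (fun t => mulEuclid M (v t)) k)
      ∂gaussPi (Fin n ⊕ Fin p) ≤
    l * (Real.log (Fintype.card T) / β + 0.1 + r * gaussianWidth (mulEuclid M '' l1ball p) - √n) := by
  obtain ⟨K, hK⟩ := exists_norm_le_of_mem_image_l1ball M
  have hB : (mulEuclid M '' l1ball p).Nonempty := ⟨_, Set.mem_image_of_mem _ zero_mem_l1ball⟩
  set W : (Fin p → ℝ) → ℝ := fun ζ => supportFun (mulEuclid M '' l1ball p) (WithLp.toLp 2 ζ)
  have hWc : Continuous W := continuous_supportFun_toLp hK hB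
  have hmap : ∀ {κ : Type} [Fintype κ] (e : κ → Fin n ⊕ Fin p), Function.Injective e →
      MeasurePreserving (fun ζ : Fin n ⊕ Fin p → ℝ => ζ ∘ e) (gaussPi _) (gaussPi κ) :=
    fun e he => ⟨measurable_pi_iff.2 fun k => measurable_pi_apply (e k),
      gaussPi_map_comp_injective he⟩
  have hNb := BddC2.smoothNorm.comp
    (PiLp.continuousLinearEquiv 2 ℝ (fun _ : Fin n => ℝ)).symm.toContinuousLinearMap
  have hWi : Integrable (fun ζ : Fin n ⊕ Fin p → ℝ => W (ζ ∘ Sum.inr)) (gaussPi _) :=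
    (hmap _ Sum.inr_injective).integrable_comp_of_integrable (integrable_supportFun hK hB)
  have hNi : Integrable (fun ζ : Fin n ⊕ Fin p → ℝ =>
      smoothNorm (WithLp.toLp 2 (ζ ∘ Sum.inl) : EuclideanSpace ℝ (Fin n))) (gaussPi _) :=
    (hmap _ Sum.inl_injective).integrable_comp_of_integrable hNb.integrable
  obtain ⟨f', f'', hf, -, -⟩ := exists_bddC2_softMin (n := n) _ hu hl hlβ hβ
  have hfi := (hf.comp (∑ k, (ContinuousLinearMap.proj (R := ℝ)
    (φ := fun _ : Fin n ⊕ Fin p => ℝ) k).smulRight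
      (vectorDir (fun t => mulEuclid M (v t)) k))).integrable
  have hE : ∫ ζ, l * (Real.log (Fintype.card T) / β -
      (smoothNorm (WithLp.toLp 2 (ζ ∘ Sum.inl) : EuclideanSpace ℝ (Fin n)) -
        r * W (ζ ∘ Sum.inr))) ∂gaussPi (Fin n ⊕ Fin p) =
      l * (Real.log (Fintype.card T) / β - (∫ ζ, smoothNorm
        (WithLp.toLp 2 ζ : EuclideanSpace ℝ (Fin n)) ∂gaussPi (Fin n) -
          r * gaussianWidth (mulEuclid M '' l1ball p))) := by
    have hNW : Integrable (fun ζ : Fin n ⊕ Fin p → ℝ =>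
        smoothNorm (WithLp.toLp 2 (ζ ∘ Sum.inl) : EuclideanSpace ℝ (Fin n)) - r * W (ζ ∘ Sum.inr))
        (gaussPi _) := hNi.sub (hWi.const_mul r)
    rw [integral_const_mul, integral_sub (integrable_const _) hNW, integral_sub hNi
      (hWi.const_mul r), integral_const_mul,
      integral_gaussPi_comp_injective Sum.inr_injective hWc,
      integral_gaussPi_comp_injective (g := fun ζ =>
        smoothNorm (WithLp.toLp 2 ζ : EuclideanSpace ℝ (Fin n))) Sum.inl_injective hNb.continuous,
      integral_supportFun hK hB]
    simp
  have hs : (10 : ℝ) ≤ √n := Real.le_sqrt_of_sq_le (by norm_num; exact_mod_cast hn)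
  have hmean := le_integral_smoothNorm (n := n) (by omega)
  have hinv : 1 / √(n : ℝ) ≤ 0.1 := by
    rw [div_le_iff₀ (by linarith)]; linarith
  refine (integral_mono (g := fun ζ => l * (Real.log (Fintype.card T) / β -
      (smoothNorm (WithLp.toLp 2 (ζ ∘ Sum.inl) : EuclideanSpace ℝ (Fin n)) -
        r * W (ζ ∘ Sum.inr)))) (by simpa [sum_apply] using hfi)
    ((((integrable_const _).sub (hNi.sub (hWi.const_mul r))).const_mul l)) fun ζ =>
      softMin_le hl hβ fun t => ?_).trans (hE.le.trans (mul_le_mul_of_nonneg_left (by linarith) hl))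
  rw [sum_smul_vectorDir]
  have := neg_inner_le_supportFun hK hr (hv t) (WithLp.toLp 2 (ζ ∘ Sum.inr))
  simp only [W]
  linarith

/-- The lower tail of the smallest norm of a Gaussian matrix acting on finitely many vectors. -/
theorem gaussPi_exists_norm_le [Nonempty T] (hn : 100 ≤ n) {M : Matrix (Fin p) (Fin p) ℝ}
    {v : T → EuclideanSpace ℝ (Fin p)} (hu : ∀ t, ‖mulEuclid M (v t)‖ = 1) {r : ℝ} (hr : 0 < r)
    (hv : ∀ t, l1norm (v t) ≤ r) {τ : ℝ} (hτ : 0 ≤ τ) :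
    (gaussPi (Fin n × Fin p)).real {ζ | ∃ t, ‖(WithLp.toLp 2 fun i =>
      inner ℝ (WithLp.toLp 2 (Function.curry ζ i)) (mulEuclid M (v t)) : EuclideanSpace ℝ (Fin n))‖ ≤
        √n - 1.2 - r * gaussianWidth (mulEuclid M '' l1ball p) - τ} ≤ Real.exp (-(τ ^ 2 / 2)) := by
  set G := gaussianWidth (mulEuclid M '' l1ball p)
  set u := fun t => mulEuclid M (v t)
  -- The parameter `l` is taken to be `τ`, the optimal Chernoff exponent. A large `β` absorbs the
  -- cardinality of `T`.
  obtain ⟨β, hβ, hτβ, hlog⟩ : ∃ β : ℝ, 0 < β ∧ τ ≤ β ∧ Real.log (Fintype.card T) / β ≤ 0.1 := by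
    have h0 : 0 ≤ Real.log (Fintype.card T) := Real.log_natCast_nonneg _
    have hpos : 0 < τ + 10 * Real.log (Fintype.card T) + 1 := by positivity
    refine ⟨τ + 10 * Real.log (Fintype.card T) + 1, hpos, by linarith, ?_⟩
    rw [div_le_iff₀ hpos]; linarith
  obtain ⟨f', f'', hf, -, -⟩ := exists_bddC2_softMin (n := n) u hu hτ hτβ hβ
  have hint : Integrable (fun ζ => Real.exp (softMin τ β (∑ k, ζ k • matrixDir u k)))
      (gaussPi (Fin n × Fin p)) := by
    simpa using hf.integrable_exp_comp (matrixDir u) (c := fun _ => 1) (by simp)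
  -- The loss `0.2` is `0.1` from the mean norm and `0.1` from the entropy; passing from the smooth
  -- norm to the norm costs a further `1`, whence `1.2`.
  set c := √n - 0.2 - r * G - τ
  have hM := mul_meas_ge_le_integral_of_nonneg (μ := gaussPi (Fin n × Fin p))
    (.of_forall fun ζ => (Real.exp_pos _).le) hint (Real.exp (-τ * c))
  have hI := integral_exp_softMin_le (n := n) u hu hτ hτβ hβ
  have hE := integral_softMin_vectorDir_le hn hu hr hv hτ hτβ hβ
  have hsub : {ζ : Fin n × Fin p → ℝ | ∃ t, ‖(WithLp.toLp 2 fun i =>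
      inner ℝ (WithLp.toLp 2 (Function.curry ζ i)) (u t) : EuclideanSpace ℝ (Fin n))‖ ≤
        √n - 1.2 - r * G - τ} ⊆
      {ζ | Real.exp (-τ * c) ≤ Real.exp (softMin τ β (∑ k, ζ k • matrixDir u k))} := by
    rintro ζ ⟨t, ht⟩
    refine Real.exp_le_exp.2 (le_trans ?_ (le_softMin hτ hβ _ t))
    rw [sum_smul_matrixDir]
    have h1 := smoothNorm_le (WithLp.toLp 2 fun i =>
      inner ℝ (WithLp.toLp 2 (Function.curry ζ i)) (u t) : EuclideanSpace ℝ (Fin n))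
    rw [neg_mul, neg_mul, neg_le_neg_iff, add_zero]
    refine mul_le_mul_of_nonneg_left ?_ hτ
    simp only [c]
    linarith
  refine (measureReal_mono hsub).trans ?_
  have h3 := hM.trans (hI.trans (Real.exp_le_exp.2 (add_le_add_left hE _)))
  rw [← le_div_iff₀' (Real.exp_pos _), ← Real.exp_sub] at h3
  refine h3.trans (Real.exp_le_exp.2 ?_)
  have := mul_le_mul_of_nonneg_left hlog hτ
  simp only [c]
  nlinarith

end Level

/-! ### From a standard Gaussian matrix to the rows of `Z` -/

section Transfer

variable {Ω : Type*} [MeasurableSpace Ω] {P : Measure Ω} [IsProbabilityMeasure P] {n p : ℕ}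
  {S : Matrix (Fin p) (Fin p) ℝ} {Z : Ω → Matrix (Fin n) (Fin p) ℝ}

theorem multivariateGaussian_zero_eq_map (S : Matrix (Fin p) (Fin p) ℝ) :
    multivariateGaussian 0 S = (gaussPi (Fin p)).map
      (fun x => mulEuclid (sqrtMatrix S) (WithLp.toLp 2 x)) := by
  rw [multivariateGaussian, ← map_pi_eq_stdGaussian, Measure.map_map (by fun_prop)
    (PiLp.continuous_toLp 2 _).measurable]
  congr 1
  ext x : 1
  simp [mulEuclid_eq, sqrtMatrix]

theorem continuous_mulEuclid (M : Matrix (Fin n) (Fin p) ℝ) : Continuous (mulEuclid M) := by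
  unfold mulEuclid
  exact (PiLp.continuous_toLp 2 _).comp (Continuous.matrix_mulVec continuous_const (by fun_prop))

theorem HasIIDGaussianRows.map_rows (hZ : HasIIDGaussianRows P Z S) :
    P.map (fun ω i => (WithLp.toLp 2 (Z ω i) : EuclideanSpace ℝ (Fin p))) =
      (gaussPi (Fin n × Fin p)).map
        (fun ζ i => mulEuclid (sqrtMatrix S) (WithLp.toLp 2 (Function.curry ζ i))) := by
  have hm : Measurable fun x : Fin p → ℝ => mulEuclid (sqrtMatrix S) (WithLp.toLp 2 x) :=
    ((continuous_mulEuclid _).comp (PiLp.continuous_toLp 2 _)).measurable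
  have h1 := (iIndepFun_iff_map_fun_eq_pi_map fun i => (hZ.hasLaw_row i).aemeasurable).1
    hZ.indep_rows
  simp only [(hZ.hasLaw_row _).map_eq, multivariateGaussian_zero_eq_map] at h1
  have : IsProbabilityMeasure ((gaussPi (Fin p)).map
      fun x => mulEuclid (sqrtMatrix S) (WithLp.toLp 2 x)) :=
    Measure.isProbabilityMeasure_map hm.aemeasurable
  rw [h1, ← Measure.pi_map_pi (μ := fun _ : Fin n => gaussPi (Fin p)) fun _ => hm.aemeasurable,
    ← gaussPi_map_curry, Measure.map_map]
  · rfl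
  · exact measurable_pi_iff.2 fun i => hm.comp (measurable_pi_apply i)
  · exact measurable_curry

theorem inner_mulEuclid_sqrtMatrix (S : Matrix (Fin p) (Fin p) ℝ)
    (x y : EuclideanSpace ℝ (Fin p)) :
    inner ℝ (mulEuclid (sqrtMatrix S) x) y = inner ℝ x (mulEuclid (sqrtMatrix S) y) := by
  have h : IsSelfAdjoint (Matrix.toEuclideanCLM (𝕜 := ℝ) (CFC.sqrt S)) :=
    (CFC.sqrt_nonneg S).isSelfAdjoint.map _
  exact h.isSymmetric x y

theorem mulEuclid_eq_toLp_inner (M : Matrix (Fin n) (Fin p) ℝ) (v : EuclideanSpace ℝ (Fin p)) :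
    mulEuclid M v = WithLp.toLp 2 fun i => inner ℝ (WithLp.toLp 2 (M i)) v := by
  ext i
  simp [mulEuclid, Matrix.mulVec, dotProduct, real_inner_eq_sum]

/-- The event depends only on the rows, whose joint law is that of `S^{1/2} ζ_i`. Self-adjointness
of `S^{1/2}` moves it onto `v`. -/
theorem HasIIDGaussianRows.measure_exists_norm_le {T : Type*} [Fintype T] [Nonempty T]
    (hZ : HasIIDGaussianRows P Z S) (hn : 100 ≤ n) {v : T → EuclideanSpace ℝ (Fin p)}
    (hu : ∀ t, ‖mulEuclid (sqrtMatrix S) (v t)‖ = 1) {r : ℝ} (hr : 0 < r)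
    (hv : ∀ t, l1norm (v t) ≤ r) {τ : ℝ} (hτ : 0 ≤ τ) :
    P {ω | ∃ t, ‖mulEuclid (Z ω) (v t)‖ ≤
      √n - 1.2 - r * gaussianWidth (mulEuclid (sqrtMatrix S) '' l1ball p) - τ} ≤
    ENNReal.ofReal (Real.exp (-(τ ^ 2 / 2))) := by
  set c := √n - 1.2 - r * gaussianWidth (mulEuclid (sqrtMatrix S) '' l1ball p) - τ
  let E : Set (Fin n → EuclideanSpace ℝ (Fin p)) :=
    {Y | ∃ t, ‖(WithLp.toLp 2 fun i => inner ℝ (Y i) (v t) : EuclideanSpace ℝ (Fin n))‖ ≤ c}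
  have hE : MeasurableSet E := by
    have : E = ⋃ t, {Y | ‖(WithLp.toLp 2 fun i => inner ℝ (Y i) (v t) :
        EuclideanSpace ℝ (Fin n))‖ ≤ c} := by ext; simp [E]
    rw [this]
    refine MeasurableSet.iUnion fun t => (isClosed_le ?_ continuous_const).measurableSet
    exact ((PiLp.continuous_toLp 2 _).comp (by fun_prop)).norm
  have hrow : AEMeasurable (fun ω i => (WithLp.toLp 2 (Z ω i) : EuclideanSpace ℝ (Fin p))) P :=
    aemeasurable_pi_iff.2 fun i => (hZ.hasLaw_row i).aemeasurable
  have hcanon : Measurable fun (ζ : Fin n × Fin p → ℝ) (i : Fin n) =>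
      mulEuclid (sqrtMatrix S) (WithLp.toLp 2 (Function.curry ζ i)) := by
    refine measurable_pi_iff.2 fun i => ((continuous_mulEuclid _).comp
      ((PiLp.continuous_toLp 2 _).comp ?_)).measurable
    unfold Function.curry
    fun_prop
  have h1 : P {ω | ∃ t, ‖mulEuclid (Z ω) (v t)‖ ≤ c} = P.map (fun ω i =>
      (WithLp.toLp 2 (Z ω i) : EuclideanSpace ℝ (Fin p))) E := by
    rw [Measure.map_apply_of_aemeasurable hrow hE]
    simp only [mulEuclid_eq_toLp_inner (n := n)]
    rfl
  rw [h1, hZ.map_rows, Measure.map_apply hcanon hE]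
  have h2 := gaussPi_exists_norm_le (n := n) hn hu hr hv hτ
  rw [measureReal_def] at h2
  refine (ENNReal.le_ofReal_iff_toReal_le (measure_ne_top _ _) (Real.exp_pos _).le).2 ?_
  refine (le_of_eq ?_).trans h2
  congr 2
  ext ζ
  simp only [E, Set.mem_preimage, Set.mem_ofPred_eq, inner_mulEuclid_sqrtMatrix, c]

end Transfer

/-! ### Countable families and peeling over the `ℓ¹` norm -/

theorem measure_iUnion_le_of_forall_finite {Ω : Type*} [MeasurableSpace Ω] {P : Measure Ω}
    {E : ℕ → Set Ω} {c : ENNReal} (h : ∀ N, P (⋃ k ≤ N, E k) ≤ c) : P (⋃ k, E k) ≤ c := by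
  rw [measure_iUnion_eq_iSup_accumulate]
  exact iSup_le fun N => by simpa [Set.accumulate] using h N

theorem l1norm_nonneg {p : ℕ} (v : EuclideanSpace ℝ (Fin p)) : 0 ≤ l1norm v :=
  Finset.sum_nonneg fun _ _ => abs_nonneg _

theorem gaussianWidth_nonneg {p : ℕ} (M : Matrix (Fin p) (Fin p) ℝ) :
    0 ≤ gaussianWidth (mulEuclid M '' l1ball p) := by
  obtain ⟨K, hK⟩ := exists_norm_le_of_mem_image_l1ball M
  refine integral_nonneg fun ξ => ?_
  have h0 : (0 : EuclideanSpace ℝ (Fin p)) ∈ mulEuclid M '' l1ball p :=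
    ⟨0, zero_mem_l1ball, by simp [mulEuclid_eq]⟩
  simpa [supportFun] using inner_le_supportFun hK h0 ξ

section Peeling

variable {Ω : Type*} [MeasurableSpace Ω] {P : Measure Ω} [IsProbabilityMeasure P] {n p : ℕ}
  {S : Matrix (Fin p) (Fin p) ℝ} {Z : Ω → Matrix (Fin n) (Fin p) ℝ}

/-- The lower tail over a countable family of normalized vectors of comparable `ℓ¹` norm. -/
theorem HasIIDGaussianRows.measure_level_le (hZ : HasIIDGaussianRows P Z S) (hn : 100 ≤ n)
    (v : ℕ → EuclideanSpace ℝ (Fin p)) (A : Set ℕ)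
    (hu : ∀ k ∈ A, ‖mulEuclid (sqrtMatrix S) (v k)‖ = 1) {s : ℝ}
    (hv : ∀ k ∈ A, l1norm (v k) * gaussianWidth (mulEuclid (sqrtMatrix S) '' l1ball p) ≤ s)
    {τ : ℝ} (hτ : 0 ≤ τ) :
    P (⋃ k, {ω | k ∈ A ∧ ‖mulEuclid (Z ω) (v k)‖ ≤ √n - 1.2 - s - τ}) ≤
      ENNReal.ofReal (Real.exp (-(τ ^ 2 / 2))) := by
  refine measure_iUnion_le_of_forall_finite fun N => ?_
  let T := {k : ℕ // k ∈ A ∧ k ≤ N}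
  have : Finite T := ((Set.finite_Iic N).subset fun k hk => hk.2 : {k | k ∈ A ∧ k ≤ N}.Finite)
  have := Fintype.ofFinite T
  rcases isEmpty_or_nonempty T with hT | hT
  · have : (⋃ k ≤ N, {ω | k ∈ A ∧ ‖mulEuclid (Z ω) (v k)‖ ≤ √n - 1.2 - s - τ}) = ∅ := by
      ext ω
      simp only [Set.mem_iUnion, Set.mem_ofPred_eq, Set.mem_empty_iff_false, iff_false]
      rintro ⟨k, hk, hA, -⟩
      exact hT.false ⟨k, hA, hk⟩
    rw [this]; simp
  -- Taking `r` as an attained maximum, rather than `s` divided by the width, covers a vanishing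
  -- width.
  obtain ⟨t₀, ht₀⟩ := Finite.exists_max fun t : T => l1norm (v t)
  have hr : 0 < l1norm (v t₀) := by
    refine lt_of_lt_of_le (norm_pos_iff.2 fun h => ?_) (norm_le_l1norm _)
    have := hu t₀ t₀.2.1
    rw [h, mulEuclid_eq, map_zero, norm_zero] at this
    exact zero_ne_one this
  refine (measure_mono ?_).trans (hZ.measure_exists_norm_le hn (v := fun t : T => v t)
    (fun t => hu t t.2.1) hr ht₀ hτ)
  intro ω hω
  simp only [Set.mem_iUnion, Set.mem_ofPred_eq] at hω ⊢
  obtain ⟨k, hk, hA, hle⟩ := hω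
  exact ⟨⟨k, hA, hk⟩, hle.trans (by linarith [hv t₀ t₀.2.1])⟩

/-- A lower bound for the norms of the images of countably many normalized vectors. -/
theorem HasIIDGaussianRows.measure_exists_le (hZ : HasIIDGaussianRows P Z S) (hn : 100 ≤ n)
    (v : ℕ → EuclideanSpace ℝ (Fin p)) (A : Set ℕ)
    (hu : ∀ k ∈ A, ‖mulEuclid (sqrtMatrix S) (v k)‖ = 1) {δ : ℝ} (hδ : 0 < δ) (hδ' : δ ≤ 1 / 7) :
    P {ω | ∃ k ∈ A, ‖mulEuclid (Z ω) (v k)‖ ≤ √n - (4.3 + √(2 * Real.log (9 / δ))) -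
      1.2 * gaussianWidth (mulEuclid (sqrtMatrix S) '' l1ball p) * l1norm (v k)} ≤
    ENNReal.ofReal δ := by
  set G := gaussianWidth (mulEuclid (sqrtMatrix S) '' l1ball p)
  have hG : 0 ≤ G := gaussianWidth_nonneg _
  set t := √(2 * Real.log (9 / δ)) with ht
  have hlog : 1 ≤ Real.log (9 / δ) := by
    rw [Real.le_log_iff_exp_le (by positivity), le_div_iff₀ hδ]
    have := Real.exp_one_lt_d9
    nlinarith [Real.exp_pos 1]
  have ht2 : t ^ 2 = 2 * Real.log (9 / δ) := Real.sq_sqrt (by linarith)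
  have ht1 : 1 ≤ t := Real.one_le_sqrt.2 (by linarith)
  have hexp : Real.exp (-(t ^ 2 / 2)) = δ / 9 := by
    rw [ht2, mul_div_cancel_left₀ _ two_ne_zero, Real.exp_neg, Real.exp_log (by positivity),
      inv_div]
  -- At level `a` the threshold is `√n - 1.2 - (a + 1) - τ a = √n - (4.3 + t) - 1.2 a`, and `a` is
  -- at most the `ℓ¹` norm times `G`. The slope `0.2` makes the tails summable, since `t ≥ 1` gives
  -- a factor `exp (-0.2 a)`.
  let τ : ℕ → ℝ := fun a => t + 2.1 + 0.2 * a
  have hτ : ∀ a, 0 ≤ τ a := fun a => by positivity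
  have hbound : ∀ a, Real.exp (-(τ a ^ 2 / 2)) ≤ δ / 9 * (5 / 6) ^ a := fun a => by
    have h1 : Real.exp (-0.2) ≤ 5 / 6 := by
      rw [Real.exp_neg, inv_le_comm₀ (Real.exp_pos _) (by norm_num)]
      have := Real.add_one_le_exp (0.2 : ℝ)
      norm_num at this ⊢
      linarith
    have h2 := pow_le_pow_left₀ (Real.exp_pos _).le h1 a
    rw [← Real.exp_nat_mul] at h2
    rw [← hexp]
    refine le_trans ?_ (mul_le_mul_of_nonneg_left h2 (Real.exp_pos _).le)
    rw [← Real.exp_add, Real.exp_le_exp]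
    have ha : (0 : ℝ) ≤ a := a.cast_nonneg
    have : (a : ℝ) ≤ t * a := le_mul_of_one_le_left ha ht1
    simp only [τ]
    nlinarith [sq_nonneg (2.1 + 0.2 * (a : ℝ))]
  have hsub : {ω | ∃ k ∈ A, ‖mulEuclid (Z ω) (v k)‖ ≤ √n - (4.3 + t) - 1.2 * G * l1norm (v k)} ⊆
      ⋃ a : ℕ, ⋃ k, {ω | k ∈ {k ∈ A | ⌊l1norm (v k) * G⌋₊ = a} ∧
        ‖mulEuclid (Z ω) (v k)‖ ≤ √n - 1.2 - (a + 1 : ℝ) - τ a} := by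
    rintro ω ⟨k, hk, hle⟩
    simp only [Set.mem_iUnion]
    refine ⟨⌊l1norm (v k) * G⌋₊, k, ⟨hk, rfl⟩, hle.trans ?_⟩
    have := Nat.floor_le (mul_nonneg (l1norm_nonneg (v k)) hG)
    simp only [τ]
    linarith
  calc _ ≤ _ := measure_mono hsub
    _ ≤ ∑' a : ℕ, ENNReal.ofReal (δ / 9 * (5 / 6) ^ a) := by
        refine (measure_iUnion_le _).trans (ENNReal.tsum_le_tsum fun a => ?_)
        refine (hZ.measure_level_le hn v _ (fun k hk => hu k hk.1) (fun k hk => ?_) (hτ a)).trans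
          (ENNReal.ofReal_le_ofReal (hbound a))
        rw [← hk.2]
        exact (Nat.lt_floor_add_one _).le
    -- The geometric series sums to `6`, and `6 δ / 9 ≤ δ`.
    _ ≤ ENNReal.ofReal δ := by
        have hs : Summable fun a : ℕ => (5 / 6 : ℝ) ^ a :=
          summable_geometric_of_lt_one (by norm_num) (by norm_num)
        rw [← ENNReal.ofReal_tsum_of_nonneg (fun a => by positivity) (hs.mul_left _),
          tsum_mul_left, tsum_geometric_of_lt_one (by norm_num) (by norm_num)]
        exact ENNReal.ofReal_le_ofReal (by linarith)

end Peeling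

/-! ### Homogeneity, density and conclusion -/

theorem mulEuclid_smul_right {m p : ℕ} (M : Matrix (Fin m) (Fin p) ℝ) (c : ℝ)
    (v : EuclideanSpace ℝ (Fin p)) : mulEuclid M (c • v) = c • mulEuclid M v := by
  simp [mulEuclid, Matrix.mulVec_smul]

theorem mulEuclid_smul_left {m p : ℕ} (M : Matrix (Fin m) (Fin p) ℝ) (c : ℝ)
    (v : EuclideanSpace ℝ (Fin p)) : mulEuclid (c • M) v = c • mulEuclid M v := by
  simp [mulEuclid, Matrix.smul_mulVec]

theorem mainTheorem6 {Ω : Type*} [MeasurableSpace Ω] (P : Measure Ω) [IsProbabilityMeasure P]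
    (n p : ℕ) (hn : 100 ≤ n) (S : Matrix (Fin p) (Fin p) ℝ) (hS : S.PosSemidef)
    (Z : Ω → Matrix (Fin n) (Fin p) ℝ) (hZ : HasIIDGaussianRows P Z S)
    (δ : ℝ) (hδ : 0 < δ) (hδ' : δ ≤ 1 / 7) :
    ENNReal.ofReal (1 - δ) ≤ P {ω | ∀ v : EuclideanSpace ℝ (Fin p),
      (1 - (4.3 + √(2 * Real.log (9 / δ))) / √(n : ℝ)) * ‖mulEuclid (sqrtMatrix S) v‖
          - 1.2 * gaussianWidth (mulEuclid (sqrtMatrix S) '' l1ball p) / √(n : ℝ) * l1norm v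
        ≤ ‖mulEuclid ((√(n : ℝ))⁻¹ • Z ω) v‖} := by
  set G := gaussianWidth (mulEuclid (sqrtMatrix S) '' l1ball p)
  have hG : 0 ≤ G := gaussianWidth_nonneg _
  have hsn : 0 < √(n : ℝ) := Real.sqrt_pos.2 (by exact_mod_cast (by omega : 0 < n))
  -- Both sides of the claim are continuous in `v` and homogeneous of degree one under positive
  -- scaling. It suffices to treat a dense sequence, normalized where `S^{1/2} v ≠ 0`; elsewhere the
  -- lower bound is nonpositive.
  let D : ℕ → EuclideanSpace ℝ (Fin p) := TopologicalSpace.denseSeq _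
  let w : ℕ → EuclideanSpace ℝ (Fin p) := fun k => ‖mulEuclid (sqrtMatrix S) (D k)‖⁻¹ • D k
  let A : Set ℕ := {k | mulEuclid (sqrtMatrix S) (D k) ≠ 0}
  have hw : ∀ k ∈ A, ‖mulEuclid (sqrtMatrix S) (w k)‖ = 1 := fun k hk => by
    rw [mulEuclid_smul_right, norm_smul, norm_inv, norm_norm,
      inv_mul_cancel₀ (norm_ne_zero_iff.2 hk)]
  have hbad := hZ.measure_exists_le hn w A hw hδ hδ'
  set bad := {ω | ∃ k ∈ A, ‖mulEuclid (Z ω) (w k)‖ ≤ √n - (4.3 + √(2 * Real.log (9 / δ))) -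
    1.2 * G * l1norm (w k)}
  set good := {ω | ∀ v : EuclideanSpace ℝ (Fin p),
      (1 - (4.3 + √(2 * Real.log (9 / δ))) / √(n : ℝ)) * ‖mulEuclid (sqrtMatrix S) v‖
          - 1.2 * G / √(n : ℝ) * l1norm v ≤ ‖mulEuclid ((√(n : ℝ))⁻¹ • Z ω) v‖}
  have hcover : Set.univ ⊆ good ∪ bad := by
    intro ω _
    by_cases hω : ω ∈ bad
    · exact Or.inr hω
    refine Or.inl fun v => ?_
    have hl1 : Continuous (l1norm : EuclideanSpace ℝ (Fin p) → ℝ) := by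
      unfold l1norm; fun_prop
    refine (TopologicalSpace.denseRange_denseSeq (EuclideanSpace ℝ (Fin p))).induction_on
      (p := fun v => (1 - (4.3 + √(2 * Real.log (9 / δ))) / √(n : ℝ)) *
        ‖mulEuclid (sqrtMatrix S) v‖ - 1.2 * G / √(n : ℝ) * l1norm v ≤
          ‖mulEuclid ((√(n : ℝ))⁻¹ • Z ω) v‖) v ?_ fun k => ?_
    · exact isClosed_le ((continuous_const.mul (continuous_mulEuclid _).norm).sub
        (continuous_const.mul hl1)) (continuous_mulEuclid _).norm
    change _ * ‖mulEuclid _ (D k)‖ - _ * l1norm (D k) ≤ ‖mulEuclid _ (D k)‖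
    by_cases hk : mulEuclid (sqrtMatrix S) (D k) = 0
    · rw [hk, norm_zero, mul_zero, zero_sub]
      have : 0 ≤ 1.2 * G / √(n : ℝ) * l1norm (D k) := mul_nonneg (by positivity) (l1norm_nonneg _)
      exact (neg_nonpos.2 this).trans (norm_nonneg _)
    · have h1 : √n - (4.3 + √(2 * Real.log (9 / δ))) - 1.2 * G * l1norm (w k) ≤
          ‖mulEuclid (Z ω) (w k)‖ := by
        by_contra hlt
        exact hω ⟨k, hk, (not_le.1 hlt).le⟩
      have hs : 0 < ‖mulEuclid (sqrtMatrix S) (D k)‖ := norm_pos_iff.2 hk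
      rw [mulEuclid_smul_left, norm_smul, norm_inv, Real.norm_of_nonneg hsn.le]
      simp only [w, mulEuclid_smul_right, norm_smul, l1norm_smul, norm_inv, norm_norm,
        abs_of_pos (inv_pos.2 hs)] at h1
      have h2 := mul_le_mul_of_nonneg_left h1 (mul_nonneg hs.le (inv_pos.2 hsn).le)
      calc _ = ‖mulEuclid (sqrtMatrix S) (D k)‖ * (√(n : ℝ))⁻¹ *
            (√n - (4.3 + √(2 * Real.log (9 / δ))) -
              1.2 * G * (‖mulEuclid (sqrtMatrix S) (D k)‖⁻¹ * l1norm (D k))) := by field_simp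
        _ ≤ _ := h2
        _ = _ := by field_simp
  -- Subadditivity of the outer measure avoids any measurability of the good event.
  have h1 : 1 ≤ P good + ENNReal.ofReal δ := by
    calc (1 : ENNReal) = P Set.univ := measure_univ.symm
      _ ≤ P good + P bad := (measure_mono hcover).trans (measure_union_le _ _)
      _ ≤ _ := add_le_add le_rfl hbad
  rw [ENNReal.ofReal_sub _ hδ.le, ENNReal.ofReal_one]
  exact tsub_le_iff_right.2 h1
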